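/- Let $\mathbb F$ be a field with algebraic closure $\overline{\mathbb F}$ and let $V$ be an $\mathbb F$-vector space of finite positive dimension. A tridiagonal pair on $V$ is an ordered pair $A,A^*$ of diagonalizable linear maps $V\to V$ such that the eigenspaces of $A$ have an ordering $V_0,\dots,V_d$ with $A^*V_i\subseteq V_{i-1}+V_i+V_{i+1}$ for all $i$ and the eigenspaces of $A^*$ have an ordering $V^*_0,\dots,V^*_\delta$ with $AV^*_i\subseteq V^*_{i-1}+V^*_i+V^*_{i+1}$ for all $i$ (with $V_{-1}=V_{d+1}=V^*_{-1}=V^*_{\delta+1}=0$; such orderings are called standard), and such that no subspace $W\neq 0,V$ satisfies both $AW\subseteq W$ and $A^*W\subseteq W$. A tridiagonal system of diameter $d$ is a sequence $\Phi=(A;\{E_i\}_{i=0}^d;A^*;\{E^*_i\}_{i=0}^d)$ where $A,A^*$ is a tridiagonal pair and $\{E_i\}$ (resp. $\{E^*_i\}$) are the projections onto the eigenspaces of $A$ (resp. $A^*$), taken in a standard order. Let $\theta_i$ (resp. $\theta^*_i$) be the eigenvalue of $A$ on $E_iV$ (resp. of $A^*$ on $E^*_iV$). $\Phi$ is a Leonard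 system if all eigenspaces of $A$ and of $A^*$ have dimension $1$. $\Phi$ has type II if $\mathrm{char}\,\mathbb F\neq2$ and $$\frac{\theta_{i-2}-\theta_{i+1}}{\theta_{i-1}-\theta_i}=\frac{\theta^*_{i-2}-\theta^*_{i+1}}{\theta^*_{i-1}-\theta^*_i}=3\qquad(2\le i\le d-1)$$ (for $d\le 2$ only $\mathrm{char}\,\mathbb F\ne 2$ is required). Let $\Phi$ be a Leonard system of type II. Its split sequence $\{\zeta_i\}_{i=0}^d$ is defined by: $\zeta_i$ is the eigenvalue of $(A^*-\theta^*_1I)\cdots(A^*-\theta^*_iI)(A-\theta_{i-1}I)\cdots(A-\theta_0I)$ on $U_0$, where $U_i=(E^*_0V+\cdots+E^*_iV)\cap(E_iV+\cdots+E_dV)$. Its first split sequence $\{\varphi_i\}_{i=1}^d$ is the unique sequence of scalars such that, with respect to some basis of $V$, $A$ is lower bidiagonal with diagonal entries $\theta_0,\dots,\theta_d$ and all subdiagonal entries $1$, while $A^*$ is upper bidiagonal with diagonal entries $\theta^*_0,\dots,\theta^*_d$ and superdiagonal entries $\varphi_1,\dots,\varphi_d$. Its second split sequence $\{\phi_i\}_{i=1}^d$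 is the first split sequence of $(A;\{E_{d-i}\}_{i=0}^d;A^*;\{E^*_i\}_{i=0}^d)$. There exist $a,b,c,a^*,b^*,c^*\in\mathbb F$ such that $$\theta_i=a+b(i-d/2)+c\,i(d-i),\qquad \theta^*_i=a^*+b^*(i-d/2)+c^*i(d-i)\qquad(0\le i\le d).$$ For any such scalars there exists $t\in\overline{\mathbb F}$ such that for $1\le i\le d$ $$\varphi_i=i(d-i+1)\Bigl(t-\tfrac{bb^*}2+(bc^*+cb^*)\bigl(i-\tfrac{d+1}2\bigr)-cc^*\bigl(i-\tfrac{d+1}2\bigr)^2\Bigr),$$ $$\phi_i=i(d-i+1)\Bigl(t+\tfrac{bb^*}2+(cb^*-bc^*)\bigl(i-\tfrac{d+1}2\bigr)-cc^*\bigl(i-\tfrac{d+1}2\bigr)^2\Bigr).$$ Let $t$ be any such scalar and define the normalized Drinfel'd polynomial $$\hat P=\sum_{i=0}^d\zeta_i\,\hat p_{i+1}\hat p_{i+2}\cdots\hat p_d\in\mathbb F[\lambda],\qquad \hat p_i=i^2\bigl(bb^*/2+(bc^*+cb^*)(d-i)+cc^*(d-i)^2-\lambda\bigr).$$ (i) Assume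 $cc^*\neq0$ and let $\psi\in\overline{\mathbb F}$ be any solution of $\psi^2=4tcc^*+b^2c^{*2}+b^{*2}c^2$. Then the roots of $\hat P$ in $\overline{\mathbb F}$, counted with multiplicity, are $$t+\psi\bigl(i-\tfrac{d+1}2\bigr)+cc^*\bigl(i-\tfrac{d+1}2\bigr)^2\qquad(1\le i\le d).$$ (ii) Assume $cc^*=0$. Then the roots of $\hat P$ in $\overline{\mathbb F}$, counted with multiplicity, are $$t+(bc^*+cb^*)\bigl(i-\tfrac{d+1}2\bigr)\qquad(1\le i\le d).$$ -/

import Mathlib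

open Polynomial

section TridiagonalPairs

variable {F : Type*} [Field F] {V : Type*} [AddCommGroup V] [Module F V]

/-- `W` is an eigenspace of `A`: it is nonzero and equals `{v | A v = x v}` for some scalar `x`. -/
def IsEigenspace (A : Module.End F V) (W : Submodule F V) : Prop :=
  W ≠ ⊥ ∧ ∃ x : F, W = A.eigenspace x

/-- `A` is diagonalizable: `V` is spanned by the eigenspaces of `A`. -/
def IsDiagonalizable (A : Module.End F V) : Prop :=
  ⨆ x : F, A.eigenspace x = ⊤

/-- `W 0, …, W d` is an ordering (without repetition) of the eigenspaces of `A`. -/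
def IsEigenspaceOrdering (A : Module.End F V) {d : ℕ} (W : Fin (d + 1) → Submodule F V) : Prop :=
  Function.Injective W ∧ Set.range W = {U | IsEigenspace A U}

/-- `W 0, …, W d` is a standard ordering of the eigenspaces of `A` with respect to `B`:
`B Wᵢ ⊆ Wᵢ₋₁ + Wᵢ + Wᵢ₊₁` for all `i`, where `W₋₁ = W_{d+1} = 0`. -/
def IsStandardOrdering (A B : Module.End F V) {d : ℕ} (W : Fin (d + 1) → Submodule F V) : Prop :=
  IsEigenspaceOrdering A W ∧
    ∀ i, (W i).map B ≤
      ⨆ (j : Fin (d + 1)) (_ : (j : ℕ) ≤ (i : ℕ) + 1 ∧ (i : ℕ) ≤ (j : ℕ) + 1), W j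

/-- A tridiagonal pair on `V`. -/
structure IsTridiagonalPair (A Astar : Module.End F V) : Prop where
  diag : IsDiagonalizable A
  diag_star : IsDiagonalizable Astar
  exists_standard : ∃ (d : ℕ) (W : Fin (d + 1) → Submodule F V), IsStandardOrdering A Astar W
  exists_standard_star :
    ∃ (d : ℕ) (W : Fin (d + 1) → Submodule F V), IsStandardOrdering Astar A W
  irreducible : ∀ W : Submodule F V, W.map A ≤ W → W.map Astar ≤ W → W = ⊥ ∨ W = ⊤

/-- A Leonard pair on `V`: a tridiagonal pair all of whose eigenspaces have dimension one. -/
def IsLeonardPair (A Astar : Module.End F V) : Prop :=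
  IsTridiagonalPair A Astar ∧
    (∀ W, IsEigenspace A W → Module.finrank F W = 1) ∧
    (∀ W, IsEigenspace Astar W → Module.finrank F W = 1)

/-- `E 0, …, E d` is a standard ordering of the primitive idempotents of `A` with respect to `B`:
for some standard ordering `W` of the eigenspaces of `A`, the map `E i` is the identity on `W i`
and vanishes on `W j` for `j ≠ i`. -/
def IsStandardIdempotents (A B : Module.End F V) {d : ℕ} (E : Fin (d + 1) → Module.End F V) :
    Prop :=
  ∃ W : Fin (d + 1) → Submodule F V, IsStandardOrdering A B W ∧
    ∀ i, (∀ v ∈ W i, E i v = v) ∧ ∀ j, j ≠ i → ∀ v ∈ W j, E i v = 0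

theorem IsStandardOrdering.rev {A B : Module.End F V} {d : ℕ} {W : Fin (d + 1) → Submodule F V}
    (h : IsStandardOrdering A B W) : IsStandardOrdering A B (fun i => W i.rev) := by
  obtain ⟨⟨hinj, hrange⟩, hstd⟩ := h
  refine ⟨⟨fun i j hij => Fin.rev_injective (hinj hij), ?_⟩, fun i => ?_⟩
  · rw [← hrange]
    exact Fin.rev_surjective.range_comp W
  · refine (hstd i.rev).trans (iSup₂_le fun j hj => ?_)
    have h1 := j.isLt
    have h2 := i.isLt
    have hj' : ((j.rev : Fin (d + 1)) : ℕ) ≤ (i : ℕ) + 1 ∧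
        (i : ℕ) ≤ ((j.rev : Fin (d + 1)) : ℕ) + 1 := by
      simp only [Fin.val_rev] at hj ⊢
      omega
    have := le_iSup₂_of_le (f := fun (k : Fin (d + 1))
      (_ : (k : ℕ) ≤ (i : ℕ) + 1 ∧ (i : ℕ) ≤ (k : ℕ) + 1) => W k.rev) j.rev hj' (le_refl _)
    simpa only [Fin.rev_rev] using this

theorem IsStandardIdempotents.rev {A B : Module.End F V} {d : ℕ}
    {E : Fin (d + 1) → Module.End F V}
    (h : IsStandardIdempotents A B E) : IsStandardIdempotents A B (fun i => E i.rev) := by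
  obtain ⟨W, hW, hE⟩ := h
  refine ⟨fun i => W i.rev, hW.rev, fun i => ⟨(hE i.rev).1, fun j hj => ?_⟩⟩
  exact (hE i.rev).2 j.rev (fun hh => hj (Fin.rev_injective hh))

end TridiagonalPairs

/-- A tridiagonal system `(A; {Eᵢ}; A*; {E*ᵢ})` of diameter `d` on `V`. -/
structure TridiagonalSystem (F : Type*) [Field F] (V : Type*) [AddCommGroup V] [Module F V]
    (d : ℕ) where
  A : Module.End F V
  E : Fin (d + 1) → Module.End F V
  Astar : Module.End F V
  Estar : Fin (d + 1) → Module.End F V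
  pair : IsTridiagonalPair A Astar
  standard : IsStandardIdempotents A Astar E
  standard_star : IsStandardIdempotents Astar A Estar

namespace TridiagonalSystem

section Basic

variable {F : Type*} [Field F] {V : Type*} [AddCommGroup V] [Module F V] {d : ℕ}

/-- The relative `Φ^⇓ = (A; {E_{d-i}}; A*; {E*ᵢ})`. -/
def ddown (Φ : TridiagonalSystem F V d) : TridiagonalSystem F V d where
  A := Φ.A
  E := fun i => Φ.E i.rev
  Astar := Φ.Astar
  Estar := Φ.Estar
  pair := Φ.pair
  standard := Φ.standard.rev
  standard_star := Φ.standard_star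

/-- `Φ` is a Leonard system. -/
def IsLeonardSystem (Φ : TridiagonalSystem F V d) : Prop :=
  IsLeonardPair Φ.A Φ.Astar

/-- The eigenvalue sequence: `θᵢ` is the scalar with `Eᵢ V = {v | A v = θᵢ v}`. -/
noncomputable def th (Φ : TridiagonalSystem F V d) (i : Fin (d + 1)) : F :=
  Classical.epsilon fun x : F => LinearMap.range (Φ.E i) = Φ.A.eigenspace x

/-- The dual eigenvalue sequence: `θ*ᵢ` is the scalar with `E*ᵢ V = {v | A* v = θ*ᵢ v}`. -/
noncomputable def thStar (Φ : TridiagonalSystem F V d) (i : Fin (d + 1)) : F :=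
  Classical.epsilon fun x : F => LinearMap.range (Φ.Estar i) = Φ.Astar.eigenspace x

/-- `β` is a base of `Φ`. If `d ≥ 3` this says that `β + 1` is the common value of
`(θᵢ₋₂ - θᵢ₊₁) / (θᵢ₋₁ - θᵢ)` and `(θ*ᵢ₋₂ - θ*ᵢ₊₁) / (θ*ᵢ₋₁ - θ*ᵢ)` for `2 ≤ i ≤ d - 1`
(the index below is `i - 2`); if `d ≤ 2` any nonzero scalar may serve as the base. -/
def IsBase (Φ : TridiagonalSystem F V d) (β : F) : Prop :=
  (∀ (i : ℕ) (h : i + 3 ≤ d),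
    (Φ.th ⟨i, by omega⟩ - Φ.th ⟨i + 3, by omega⟩) /
        (Φ.th ⟨i + 1, by omega⟩ - Φ.th ⟨i + 2, by omega⟩) = β + 1 ∧
    (Φ.thStar ⟨i, by omega⟩ - Φ.thStar ⟨i + 3, by omega⟩) /
        (Φ.thStar ⟨i + 1, by omega⟩ - Φ.thStar ⟨i + 2, by omega⟩) = β + 1) ∧
  (d ≤ 2 → β ≠ 0)

/-- `Φ` has type II: the base is `2` and the characteristic is not `2`. -/
def IsTypeII (Φ : TridiagonalSystem F V d) : Prop :=
  Φ.IsBase 2 ∧ ringChar F ≠ 2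

/-- The component `Uᵢ = (E*₀V + ⋯ + E*ᵢV) ∩ (EᵢV + ⋯ + E_dV)` of the split decomposition. -/
def splitSpace (Φ : TridiagonalSystem F V d) (i : Fin (d + 1)) : Submodule F V :=
  (⨆ j ∈ Set.Iic i, LinearMap.range (Φ.Estar j)) ⊓ (⨆ j ∈ Set.Ici i, LinearMap.range (Φ.E j))

/-- The operator `(A* - θ*₁)⋯(A* - θ*ᵢ)(A - θᵢ₋₁)⋯(A - θ₀)`. -/
noncomputable def splitOperator (Φ : TridiagonalSystem F V d) (i : Fin (d + 1)) :
    Module.End F V :=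
  aeval Φ.Astar (∏ h ∈ Finset.Ioc 0 i, (X - C (Φ.thStar h))) *
    aeval Φ.A (∏ h ∈ Finset.Iio i, (X - C (Φ.th h)))

/-- The split sequence: `ζᵢ` is the eigenvalue of `splitOperator i` on the (one-dimensional, for a
Leonard system) space `U₀`. -/
noncomputable def splitSeq (Φ : TridiagonalSystem F V d) (i : Fin (d + 1)) : F :=
  Classical.epsilon fun z : F => ∀ u ∈ Φ.splitSpace 0, Φ.splitOperator i u = z • u

/-- `φ₁, …, φ_d` (the values of `φ` at `1, …, d`) put `Φ` in split form: with respect to some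
basis of `V` the map `A` is lower bidiagonal with diagonal `θ₀, …, θ_d` and subdiagonal
`1, …, 1`, and `A*` is upper bidiagonal with diagonal `θ*₀, …, θ*_d` and superdiagonal
`φ₁, …, φ_d`. -/
def IsSplitForm (Φ : TridiagonalSystem F V d) (φ : ℕ → F) : Prop :=
  ∃ u : Module.Basis (Fin (d + 1)) F V,
    LinearMap.toMatrix u u Φ.A = Matrix.of (fun i j : Fin (d + 1) =>
      if i = j then Φ.th i else if (i : ℕ) = (j : ℕ) + 1 then 1 else 0) ∧
    LinearMap.toMatrix u u Φ.Astar = Matrix.of (fun i j : Fin (d + 1) =>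
      if i = j then Φ.thStar i else if (j : ℕ) = (i : ℕ) + 1 then φ j else 0)

/-- The first split sequence `φ₁, …, φ_d` of a Leonard system (only the values at `1, …, d` are
meaningful). -/
noncomputable def firstSplit (Φ : TridiagonalSystem F V d) : ℕ → F :=
  Classical.epsilon fun φ : ℕ → F => Φ.IsSplitForm φ

/-- The second split sequence `ϕ₁, …, ϕ_d` of a Leonard system: the first split sequence of
`Φ^⇓`. -/
noncomputable def secondSplit (Φ : TridiagonalSystem F V d) : ℕ → F :=
  Φ.ddown.firstSplit

/-- The scalars `a, b, c, a*, b*, c*` parametrize the eigenvalues of a system of type II. -/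
def IsTypeIIParam (Φ : TridiagonalSystem F V d) (a b c a' b' c' : F) : Prop :=
  ∀ i : Fin (d + 1),
    Φ.th i = a + b * ((i : ℕ) - (d : F) / 2) + c * (i : ℕ) * ((d : F) - (i : ℕ)) ∧
    Φ.thStar i = a' + b' * ((i : ℕ) - (d : F) / 2) + c' * (i : ℕ) * ((d : F) - (i : ℕ))

/-- The polynomial
`p̂ᵢ = i² (b b*/2 + (b c* + c b*)(d - i) + c c* (d - i)² - λ)` of a system of type II. -/
noncomputable def normP (d : ℕ) (b c b' c' : F) (i : ℕ) : F[X] :=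
  C ((i : F) ^ 2) *
    (C (b * b' / 2 + (b * c' + c * b') * ((d : F) - i) + c * c' * ((d : F) - i) ^ 2) - X)

/-- The normalized Drinfel'd polynomial `P̂ = ∑ᵢ ζᵢ p̂ᵢ₊₁ ⋯ p̂_d` of a system of type II. -/
noncomputable def normDrinfeld (Φ : TridiagonalSystem F V d) (b c b' c' : F) : F[X] :=
  ∑ i : Fin (d + 1),
    C (Φ.splitSeq i) * ∏ j ∈ Finset.Icc ((i : ℕ) + 1) d, normP d b c b' c' j

/-- The defining property of the scalar `t` of a Leonard system of type II, in terms of the first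
and second split sequences. The scalars `b, c, b*, c*` are viewed in the
algebraic closure. -/
def IsSplitParam (Φ : TridiagonalSystem F V d) (b c b' c' t : AlgebraicClosure F) : Prop :=
  ∀ i ∈ Finset.Icc 1 d,
    algebraMap F (AlgebraicClosure F) (Φ.firstSplit i) =
      i * ((d : AlgebraicClosure F) - i + 1) *
        (t - b * b' / 2 + (b * c' + c * b') * (i - ((d : AlgebraicClosure F) + 1) / 2)
          - c * c' * (i - ((d : AlgebraicClosure F) + 1) / 2) ^ 2) ∧
    algebraMap F (AlgebraicClosure F) (Φ.secondSplit i) =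
      i * ((d : AlgebraicClosure F) - i + 1) *
        (t + b * b' / 2 + (c * b' - b * c') * (i - ((d : AlgebraicClosure F) + 1) / 2)
          - c * c' * (i - ((d : AlgebraicClosure F) + 1) / 2) ^ 2)

end Basic

end TridiagonalSystem

/-! The polynomial `P̂` is a terminating hypergeometric sum in disguise. In a split basis `u 0, …, u
d` the map `A` raises and `A*` lowers, so going from `u 0` up to `u i` and back multiplies by φ₁⋯φᵢ;
hence ζᵢ = φ₁⋯φᵢ (`IsLeonardSystem.splitSeq_eq`). With φ in closed form, `P̂` evaluated at any
scalar `L` is a sum to which Pfaff–Saalschütz (`saalschuetz_sum`) applies, and it collapses to (d!)²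
times a product of factors linear in `L`, from which the roots are read off. The summation applies
because, with x = i - (d+1)/2, the quadratic T + βx - αx² inside φᵢ and the quadratic T + ψx + αx²
inside the claimed root factor simultaneously as (p+ux)(q-vx) and (p+ux)(q+vx) once ψ² = β² + 4αT
(`exists_common_factorization`). The scalar d! is nonzero in the field because the eigenvalues are
distinct.

The existence of t rests on the closed form of φ (`IsLeonardSystem.exists_firstSplit_eq`). Since the
eigenvalues are quadratic in i, `A` and `A*` satisfy a cubic tridiagonal relation, one coefficient
of which prescribes the third differences of φ (`IsSplitBasis.third_difference`). What remains is
fixed by the convention φ₀ = 0, by φ₁, which is the free parameter t, and by φ_d - φ₁, which follows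
from comparing the system with its relative `Φ^⇓` through corner matrix entries that both share. The
second split sequence is the same result for `Φ^⇓`, where b changes sign. -/

/-! ### Saalschütz summation and the product formula -/

/-- A division-free form of the Pfaff–Saalschütz summation. -/
theorem saalschuetz_sum {R : Type*} [CommRing R] (u v L q : R) (n : ℕ) (p : R) :
    ∑ m ∈ Finset.range (n + 1), (n.choose m : R) *
        (∏ j ∈ Finset.range (n - m), (p + u * j) * (q - v * j)) *
        (∏ y ∈ Finset.range m,
          ((u * q - v * p - u * v * ((n : R) - 1)) * y + u * v * (y : R) ^ 2 - L)) =
      ∏ j ∈ Finset.range n, ((p + u * j) * (q - v * ((n : R) - 1 - j)) - L) := by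
  induction n generalizing p with
  | zero => simp
  | succ n ih =>
    rw [Finset.prod_range_succ']
    have ih' := ih (p + u)
    -- `B` is the same for (n + 1, p) and (n, p + u), so the two sums share the factors `r`.
    set B : R := u * q - v * p - u * v * n with hB
    have e1 : u * q - v * (p + u) - u * v * ((n : R) - 1) = B := by rw [hB]; ring
    have e2 : u * q - v * p - u * v * (((n + 1 : ℕ) : R) - 1) = B := by rw [hB]; push_cast; ring
    rw [e1] at ih'
    rw [e2]
    set r : ℕ → R := fun m => ∏ y ∈ Finset.range m, (B * y + u * v * (y : R) ^ 2 - L) with hr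
    have hr1 (m : ℕ) : r (m + 1) = r m * (B * m + u * v * (m : R) ^ 2 - L) :=
      Finset.prod_range_succ _ _
    set a : ℕ → R := fun k => ∏ j ∈ Finset.range k, (p + u + u * j) * (q - v * j) with ha
    have ha1 (k : ℕ) : a (k + 1) = a k * ((p + u + u * k) * (q - v * k)) :=
      Finset.prod_range_succ _ _
    have ha0 (k : ℕ) : (∏ j ∈ Finset.range k, (p + u * j) * (q - v * j)) * (p + u * k) =
        a k * p := by
      induction k with
      | zero => simp [ha]
      | succ k ihk =>
        rw [Finset.prod_range_succ, ha1]
        push_cast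
        linear_combination (q - v * k) * (p + u * (k + 1)) * ihk
    have ha2 (k : ℕ) : ∏ j ∈ Finset.range (k + 1), (p + u * j) * (q - v * j) =
        a k * p * (q - v * k) := by
      rw [Finset.prod_range_succ, ← ha0]; ring
    -- `W` is the factor j = 0 of the product; it remains to show that the sum for (n + 1, p) is `W`
    -- times the sum for (n, p + u).
    set W : R := p * (q - v * n) - L with hW
    -- The difference of the two summands telescopes; the right-hand side is the explicit
    -- antidifference, verified by Pascal's rule and the ratio of consecutive binomials.
    have tele (m : ℕ) (hm : m ≤ n) : ∑ i ∈ Finset.range m,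
        (((n + 1).choose i : R) * (∏ j ∈ Finset.range (n + 1 - i), (p + u * j) * (q - v * j)) * r i
          - W * ((n.choose i : R) * a (n - i) * r i)) =
        - (r m * a (n - m) * (q - v * ((n : R) - m)) *
          (p * (((n + 1).choose m : R) - n.choose m) + u * m * n.choose m)) := by
      induction m with
      | zero => simp
      | succ m ihm =>
        obtain ⟨k, rfl⟩ : ∃ k, n = m + 1 + k := ⟨n - (m + 1), by omega⟩
        rw [Finset.sum_range_succ, ihm (by omega)]
        have h1 : m + 1 + k + 1 - m = (k + 1) + 1 := by omega
        have h2 : m + 1 + k - m = k + 1 := by omega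
        have h3 : m + 1 + k - (m + 1) = k := by omega
        have c1 : (((m + 1 + k).choose (m + 1) : ℕ) : R) * (m + 1) =
            ((m + 1 + k).choose m : ℕ) * (k + 1) := by
          have := Nat.choose_succ_right_eq (m + 1 + k) m
          rw [h2] at this
          exact_mod_cast congrArg (Nat.cast : ℕ → R) this
        have c2 : ((((m + 1 + k) + 1).choose (m + 1) : ℕ) : R) =
            ((m + 1 + k).choose m : ℕ) + ((m + 1 + k).choose (m + 1) : ℕ) := by
          rw [Nat.choose_succ_succ]; push_cast; rfl
        rw [h1, h2, h3, ha2, ha1, hr1, c2]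
        rw [hW, hB]
        push_cast
        linear_combination (r m * a k * (q - v * k) * u *
          ((u * q - v * p - u * v * (m + 1 + k)) * m + u * v * (m : R) ^ 2 - L)) * c1
    have hn := tele n le_rfl
    have hprod : ∏ k ∈ Finset.range n, ((p + u * ((k + 1 : ℕ) : R)) *
          (q - v * (((n + 1 : ℕ) : R) - 1 - ((k + 1 : ℕ) : R))) - L) =
        ∏ j ∈ Finset.range n, ((p + u + u * j) * (q - v * ((n : R) - 1 - j)) - L) := by
      refine Finset.prod_congr rfl fun k _ => ?_
      push_cast; ring
    rw [hprod, ← ih', Finset.sum_range_succ, Finset.sum_range_succ, Finset.sum_range_succ]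
    rw [Finset.sum_sub_distrib, ← Finset.mul_sum] at hn
    have h1 : n + 1 - n = 0 + 1 := by omega
    rw [h1, ha2]
    have a0 : a 0 = 1 := by simp [ha]
    simp only [Nat.sub_self, Finset.range_zero, Finset.prod_empty, Nat.choose_self,
      Nat.choose_succ_self_right, a0, Nat.cast_add, Nat.cast_one, Nat.cast_zero] at hn ⊢
    have hr1n := hr1 n
    simp only [hr] at hn hr1n ⊢
    rw [hr1n]
    rw [hW, hB] at *
    linear_combination hn

/-- The prefactors k(d-k+1) of φₖ and j² of p̂ⱼ combine into (d!)² times the binomial coefficient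
that Saalschütz needs. -/
theorem factorial_mul_prod_sub_eq (d i : ℕ) (hi : i ≤ d) :
    (∏ j ∈ Finset.range i, (j + 1) * (d - j)) * (∏ y ∈ Finset.range (d - i), (d - y) ^ 2) =
      d.factorial ^ 2 * d.choose (d - i) := by
  have h1 := Nat.descFactorial_eq_prod_range d i
  have h2 := Nat.descFactorial_eq_prod_range d (d - i)
  rw [Finset.prod_mul_distrib, Finset.prod_range_add_one_eq_factorial, Finset.prod_pow, ← h1, ← h2,
    Nat.descFactorial_eq_factorial_mul_choose, Nat.descFactorial_eq_factorial_mul_choose,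
    Nat.choose_symm hi, ← Nat.choose_mul_factorial_mul_factorial hi]
  ring

theorem prod_Icc_one_eq_prod_range {M : Type*} [CommMonoid M] (f : ℕ → M) (n : ℕ) :
    ∏ k ∈ Finset.Icc 1 n, f k = ∏ j ∈ Finset.range n, f (j + 1) := by
  rw [Finset.range_eq_Ico, Finset.prod_Ico_add' f 0 n 1, zero_add]
  rfl

theorem prod_Icc_succ_eq_prod_range_sub {M : Type*} [CommMonoid M] (f : ℕ → M) {i d : ℕ}
    (hi : i ≤ d) :
    ∏ k ∈ Finset.Icc (i + 1) d, f k = ∏ y ∈ Finset.range (d - i), f (d - y) := by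
  refine (Finset.prod_bij (fun y _ => d - y) ?_ ?_ ?_ ?_).symm
  · intro y hy
    simp only [Finset.mem_range, Finset.mem_Icc] at *
    omega
  · intro y hy z hz h
    simp only [Finset.mem_range] at *
    omega
  · intro k hk
    simp only [Finset.mem_range, Finset.mem_Icc] at *
    exact ⟨d - k, by omega, by omega⟩
  · intros; rfl

/-- Factorization of the quadratics `T + βx - αx²` and `T + ψx + αx²` when
`ψ² = β² + 4αT`. -/
theorem exists_common_factorization {K : Type*} [Field K] (h2 : (2 : K) ≠ 0) {α β T ψ : K}
    (hψ : ψ ^ 2 = β ^ 2 + 4 * α * T) (hα : α = 0 → ψ = β) :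
    ∃ p q u v : K, u * v = α ∧ u * q - v * p = β ∧ u * q + v * p = ψ ∧ p * q = T := by
  by_cases h : α = 0
  · exact ⟨T, 1, β, 0, by simp [h], by ring, by rw [hα h]; ring, by ring⟩
  -- Normalizing v = 1 forces u = α; then uq and vp are half the sum and half the difference of ψ
  -- and β.
  · refine ⟨(ψ - β) / 2, (ψ + β) / (2 * α), α, 1, by ring, ?_, ?_, ?_⟩
    · field_simp; ring
    · field_simp; ring
    · field_simp
      linear_combination hψ

/-- The Saalschütz sum in coordinates centred at (d+1)/2, with the order of summation reversed. For
α = 0 the hypothesis on ψ² only gives ψ = ±β; `hα` fixes the sign. -/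
theorem hypergeometric_sum_eq_prod {K : Type*} [Field K] (h2 : (2 : K) ≠ 0)
    (d : ℕ) {α β γ t ψ : K} (hψ : ψ ^ 2 = β ^ 2 + 4 * α * (t - γ)) (hα : α = 0 → ψ = β) (L : K) :
    ∑ i ∈ Finset.range (d + 1),
      (∏ k ∈ Finset.Icc 1 i, ((k : K) * ((d : K) - k + 1) *
        (t - γ + β * (k - ((d : K) + 1) / 2) - α * (k - ((d : K) + 1) / 2) ^ 2))) *
      ∏ j ∈ Finset.Icc (i + 1) d,
        ((j : K) ^ 2 * (γ + β * ((d : K) - j) + α * ((d : K) - j) ^ 2 - L)) =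
    (d.factorial : K) ^ 2 * ∏ i ∈ Finset.Icc 1 d,
      (t + ψ * (i - ((d : K) + 1) / 2) + α * (i - ((d : K) + 1) / 2) ^ 2 - L) := by
  obtain ⟨p, q, u, v, huv, hβ, hψ', hT⟩ := exists_common_factorization h2 hψ hα
  have ht : t = γ + p * q := by rw [hT]; ring
  subst ht huv hβ hψ'
  -- The shifts by (d-1)/2 turn j = k - 1 into k - (d+1)/2, and cancel the term uv(d-1) so that the
  -- linear coefficient becomes uq - vp = β.
  have key := saalschuetz_sum u v (L - γ) (q + v * (((d : K) - 1) / 2)) d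
    (p - u * (((d : K) - 1) / 2))
  rw [prod_Icc_one_eq_prod_range]
  have hR : ∏ j ∈ Finset.range d, ((p - u * (((d : K) - 1) / 2) + u * j) *
      (q + v * (((d : K) - 1) / 2) - v * ((d : K) - 1 - j)) - (L - γ)) =
      ∏ k ∈ Finset.range d, (γ + p * q + (u * q + v * p) * (((k + 1 : ℕ) : K) - ((d : K) + 1) / 2)
        + u * v * (((k + 1 : ℕ) : K) - ((d : K) + 1) / 2) ^ 2 - L) := by
    refine Finset.prod_congr rfl fun k _ => ?_
    push_cast
    field_simp
    ring
  rw [hR] at key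
  rw [← key, Finset.mul_sum, ← Finset.sum_range_reflect]
  refine Finset.sum_congr rfl fun m hm => ?_
  obtain ⟨i, rfl⟩ : ∃ i, d = m + i := ⟨d - m, by have := Finset.mem_range.1 hm; omega⟩
  have e1 : m + i + 1 - 1 - m = i := by omega
  have e2 : m + i - i = m := by omega
  have e3 : m + i - m = i := by omega
  rw [e1, prod_Icc_one_eq_prod_range, prod_Icc_succ_eq_prod_range_sub _ (by omega), e2, e3]
  have hc := congrArg (Nat.cast : ℕ → K) (factorial_mul_prod_sub_eq (m + i) i (by omega))
  rw [e2] at hc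
  rw [Nat.cast_mul, Nat.cast_mul, Nat.cast_prod, Nat.cast_prod, Nat.cast_pow] at hc
  conv_rhs => rw [mul_assoc ((m + i).choose m : K), ← mul_assoc, ← hc, mul_mul_mul_comm,
    ← Finset.prod_mul_distrib, ← Finset.prod_mul_distrib]
  congr 1
  · refine Finset.prod_congr rfl fun k hk => ?_
    rw [Nat.cast_mul, Nat.cast_sub (by have := Finset.mem_range.1 hk; omega)]
    push_cast
    field_simp
    ring
  · refine Finset.prod_congr rfl fun k hk => ?_
    rw [Nat.cast_pow, Nat.cast_sub (by have := Finset.mem_range.1 hk; omega)]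
    push_cast
    field_simp
    ring

theorem roots_C_mul_prod_C_sub_X {K ι : Type*} [Field K] {a : K} (ha : a ≠ 0) (s : Finset ι)
    (r : ι → K) : (C a * ∏ i ∈ s, (C (r i) - X)).roots = s.val.map r := by
  have h : ∏ i ∈ s, (C (r i) - X) = C ((-1) ^ s.card) * (s.val.map fun i => X - C (r i)).prod := by
    rw [map_pow, Finset.card_eq_sum_ones]
    change _ = _ * ∏ i ∈ s, (X - C (r i))
    rw [← Finset.card_eq_sum_ones, ← Finset.prod_const, ← Finset.prod_mul_distrib]
    refine Finset.prod_congr rfl fun i _ => ?_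
    rw [C_neg, C_1]; ring
  rw [h, ← mul_assoc, ← C_mul, roots_C_mul _ (mul_ne_zero ha (by simp))]
  have := roots_multiset_prod_X_sub_C (s.val.map r)
  rwa [Multiset.map_map] at this

/-! ### Eigenvector bases and the split basis -/

section ExtendNat

variable {F : Type*} {d : ℕ}

/-- Extension of a finite sequence to the natural numbers. -/
def extendNat (x : Fin (d + 1) → F) (n : ℕ) : F := x (Fin.ofNat (d + 1) n)

theorem extendNat_of_lt (x : Fin (d + 1) → F) {n : ℕ} (h : n < d + 1) :
    extendNat x n = x ⟨n, h⟩ := by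
  unfold extendNat; congr 1; ext; simp [Nat.mod_eq_of_lt h]

@[simp] theorem extendNat_val (x : Fin (d + 1) → F) (i : Fin (d + 1)) : extendNat x i = x i :=
  extendNat_of_lt x i.isLt

theorem extendNat_injOn {x : Fin (d + 1) → F} (hx : Function.Injective x) {i j : ℕ} (hi : i ≤ d)
    (hj : j ≤ d) (h : extendNat x i = extendNat x j) : i = j := by
  rw [extendNat_of_lt x (Nat.lt_succ_of_le hi), extendNat_of_lt x (Nat.lt_succ_of_le hj)] at h
  exact congrArg Fin.val (hx h)

end ExtendNat

section LeonardPairs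

variable {F : Type*} [Field F] {V : Type*} [AddCommGroup V] [Module F V] {d : ℕ}

/-- `v` is a basis of eigenvectors of `A`, with distinct eigenvalues `x`, with respect to which the
matrix of `B` is tridiagonal. -/
structure IsTridiagonalEigenbasis (A B : Module.End F V) (x : Fin (d + 1) → F)
    (v : Module.Basis (Fin (d + 1)) F V) : Prop where
  inj : Function.Injective x
  apply_eq : ∀ i, A (v i) = x i • v i
  repr_eq_zero : ∀ i j : Fin (d + 1), ¬((j : ℕ) ≤ (i : ℕ) + 1 ∧ (i : ℕ) ≤ (j : ℕ) + 1) →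
    v.repr (B (v i)) j = 0

/-- One nonzero vector from each one-dimensional eigenspace gives the basis, spanning because the
map is diagonalizable. The last conjunct is what later pins down the eigenvalues defined by choice.
-/
theorem IsStandardIdempotents.exists_eigenbasis {A B : Module.End F V}
    {E : Fin (d + 1) → Module.End F V} (hd : IsDiagonalizable A)
    (h1 : ∀ W, IsEigenspace A W → Module.finrank F W = 1) (hE : IsStandardIdempotents A B E) :
    ∃ (x : Fin (d + 1) → F) (v : Module.Basis (Fin (d + 1)) F V),
      IsTridiagonalEigenbasis A B x v ∧ (∀ i, LinearMap.range (E i) = Submodule.span F {v i}) ∧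
      ∀ i, LinearMap.range (E i) = A.eigenspace (x i) := by
  obtain ⟨W, ⟨⟨hinj, hrange⟩, hstd⟩, hE⟩ := hE
  have hW (i) : IsEigenspace A (W i) := by
    have : W i ∈ Set.range W := ⟨i, rfl⟩
    rwa [hrange] at this
  choose hne x hx using hW
  choose v hvW hv0 using fun i => Submodule.exists_mem_ne_zero_of_ne_bot (hne i)
  have hspan (i) : W i = Submodule.span F {v i} := by
    refine le_antisymm (fun w hw => ?_) (by simpa using hvW i)
    obtain ⟨c, hc⟩ := exists_smul_eq_of_finrank_eq_one (h1 (W i) ⟨hne i, x i, hx i⟩)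
      (x := ⟨v i, hvW i⟩) (by simpa using hv0 i) ⟨w, hw⟩
    exact Submodule.mem_span_singleton.2 ⟨c, congrArg Subtype.val hc⟩
  have xinj : Function.Injective x := fun i j hij => hinj (by rw [hx, hx, hij])
  have hAv (i) : A (v i) = x i • v i := by
    have := hvW i
    rwa [hx, Module.End.mem_eigenspace_iff] at this
  have li : LinearIndependent F v := Module.End.eigenvectors_linearIndependent' A x xinj v
    fun i => ⟨Module.End.mem_eigenspace_iff.2 (hAv i), hv0 i⟩
  have hsp : ⊤ ≤ Submodule.span F (Set.range v) := by
    rw [← hd]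
    refine iSup_le fun y => ?_
    by_cases hy : A.eigenspace y = ⊥
    · simp [hy]
    · have : A.eigenspace y ∈ Set.range W := by
        rw [hrange]; exact ⟨hy, y, rfl⟩
      obtain ⟨i, hi⟩ := this
      rw [← hi, hspan]
      exact Submodule.span_mono (by simp)
  let b := Module.Basis.mk li hsp
  have hb (i) : b i = v i := by simp [b]
  have hEb (i w) : E i w = b.repr w i • b i := by
    conv_lhs => rw [← b.sum_repr w]
    rw [map_sum, Finset.sum_eq_single i]
    · rw [map_smul, hb, (hE i).1 _ (hvW i)]
    · intro j _ hj
      rw [map_smul, hb, (hE i).2 j hj _ (hvW j), smul_zero]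
    · simp
  have hrE (i) : LinearMap.range (E i) = Submodule.span F {b i} := by
    ext w
    rw [LinearMap.mem_range, Submodule.mem_span_singleton]
    constructor
    · rintro ⟨y, rfl⟩
      exact ⟨_, (hEb i y).symm⟩
    · rintro ⟨c, rfl⟩
      exact ⟨c • b i, by simp [hEb]⟩
  refine ⟨x, b, ⟨xinj, fun i => by rw [hb, hAv], fun i j hij => ?_⟩, hrE, fun i => ?_⟩
  · have hm : B (b i) ∈ (W i).map B := ⟨v i, hvW i, by rw [hb]⟩
    have hle : (⨆ (j : Fin (d + 1)) (_ : (j : ℕ) ≤ (i : ℕ) + 1 ∧ (i : ℕ) ≤ (j : ℕ) + 1), W j) ≤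
        LinearMap.ker (b.coord j) := by
      refine iSup₂_le fun k hk => ?_
      rw [hspan, Submodule.span_singleton_le_iff_mem, LinearMap.mem_ker, Module.Basis.coord_apply,
        ← hb, b.repr_self, Finsupp.single_eq_of_ne]
      rintro rfl
      exact hij hk
    exact hle (hstd i hm)
  · rw [hrE, ← hx, hspan, hb]

/-- Vector form of the split form: `A uᵢ = xᵢ uᵢ + uᵢ₊₁` and `B uᵢ = yᵢ uᵢ + φᵢ uᵢ₋₁`, for a basis
`u₀, …, u_d` indexed by the natural numbers, with `uᵢ = 0` for `i > d`. -/
structure IsSplitBasis (d : ℕ) (A B : Module.End F V) (x y φ : ℕ → F) (u : ℕ → V) : Prop where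
  li : LinearIndependent F fun i : Fin (d + 1) => u i
  span : ⊤ ≤ Submodule.span F (Set.range fun i : Fin (d + 1) => u i)
  eq_zero : ∀ i, d < i → u i = 0
  raise : ∀ i ≤ d, A (u i) = x i • u i + u (i + 1)
  lower_zero : B (u 0) = y 0 • u 0
  lower : ∀ i < d, B (u (i + 1)) = y (i + 1) • u (i + 1) + φ (i + 1) • u i

/-- The sequence `w, (A - x₀) w, (A - x₁)(A - x₀) w, …`. -/
def splitVec (A : Module.End F V) (x : ℕ → F) (w : V) : ℕ → V
  | 0 => w
  | n + 1 => A (splitVec A x w n) - x n • splitVec A x w n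

end LeonardPairs

section LeonardPairs

variable {F : Type*} [Field F] {V : Type*} [AddCommGroup V] [Module F V] {d : ℕ}

/-- Coordinate functionals, indexed by the natural numbers. -/
theorem exists_dual_family {u : ℕ → V} (li : LinearIndependent F fun i : Fin (d + 1) => u i)
    (sp : ⊤ ≤ Submodule.span F (Set.range fun i : Fin (d + 1) => u i))
    (h0 : ∀ i, d < i → u i = 0) :
    ∃ f : ℕ → Module.Dual F V, (∀ k j, k ≤ d → f k (u j) = if j = k then 1 else 0) ∧
      ∀ z, z = ∑ k ∈ Finset.range (d + 1), f k z • u k := by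
  let b := Module.Basis.mk li sp
  have hb (i : Fin (d + 1)) : b i = u i := by simp [b]
  refine ⟨fun k => b.coord (Fin.ofNat (d + 1) k), fun k j hk => ?_, fun z => ?_⟩
  · have hkv : ((Fin.ofNat (d + 1) k : Fin (d + 1)) : ℕ) = k := by
      simp [Nat.mod_eq_of_lt (Nat.lt_succ_of_le hk)]
    by_cases hj : d < j
    · rw [h0 j hj, map_zero, if_neg (by omega)]
    · have hju : u j = b ⟨j, by omega⟩ := (hb ⟨j, by omega⟩).symm
      rw [hju, Module.Basis.coord_apply, b.repr_self, Finsupp.single_apply]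
      congr 1
      rw [Fin.ext_iff, hkv]
  · conv_lhs => rw [← b.sum_repr z]
    rw [Finset.sum_range]
    refine Finset.sum_congr rfl fun i _ => ?_
    rw [hb, Module.Basis.coord_apply]
    congr 3
    ext; simp

/-- The transpose of the raising relation: the coordinate functional of index 0 is a left
eigenvector of `A`, and the later ones form a chain above it. -/
theorem dual_family_raise {A : Module.End F V} {x : ℕ → F} {u : ℕ → V} {f : ℕ → Module.Dual F V}
    (hf : ∀ k j, k ≤ d → f k (u j) = if j = k then 1 else 0)
    (hs : ∀ z, z = ∑ k ∈ Finset.range (d + 1), f k z • u k)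
    (hA : ∀ i ≤ d, A (u i) = x i • u i + u (i + 1)) (z : V) :
    f 0 (A z) = x 0 * f 0 z ∧
      ∀ k, k + 1 ≤ d → f (k + 1) (A z) = x (k + 1) * f (k + 1) z + f k z := by
  have hAz : A z = ∑ k ∈ Finset.range (d + 1), f k z • (x k • u k + u (k + 1)) := by
    conv_lhs => rw [hs z]
    rw [map_sum]
    refine Finset.sum_congr rfl fun k hk => ?_
    rw [map_smul, hA k (by simpa [Nat.lt_succ_iff] using hk)]
  refine ⟨?_, fun k hk => ?_⟩
  · rw [hAz, map_sum, Finset.sum_eq_single 0]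
    · rw [map_smul, map_add, map_smul, hf _ _ (by omega), hf _ _ (by omega)]
      simp [mul_comm]
    · intro j _ hj
      rw [map_smul, map_add, map_smul, hf _ _ (by omega), hf _ _ (by omega)]
      simp [hj]
    · simp
  · rw [hAz, map_sum, Finset.sum_eq_add_of_mem (k + 1) k]
    · rw [map_smul, map_add, map_smul, hf _ _ (by omega), hf _ _ (by omega), map_smul, map_add,
        map_smul, hf _ _ (by omega), hf _ _ (by omega)]
      simp [mul_comm]
    · simp; omega
    · simp; omega
    · omega
    · intro j _ hj
      rw [map_smul, map_add, map_smul, hf _ _ (by omega), hf _ _ (by omega)]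
      simp [hj.1, hj.2]

/-- The span of `w 0, …, w (n - 1)`. -/
def lowSpace (w : Module.Basis (Fin (d + 1)) F V) (n : ℕ) : Submodule F V where
  carrier := {z | ∀ j : Fin (d + 1), n ≤ j → w.repr z j = 0}
  add_mem' ha hb j hj := by simp [ha j hj, hb j hj]
  zero_mem' j _ := by simp
  smul_mem' c z hz j hj := by simp [hz j hj]

/-- The span of `v n, …, v d`. -/
def highSpace (v : Module.Basis (Fin (d + 1)) F V) (n : ℕ) : Submodule F V where
  carrier := {z | ∀ j : Fin (d + 1), (j : ℕ) < n → v.repr z j = 0}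
  add_mem' ha hb j hj := by simp [ha j hj, hb j hj]
  zero_mem' j _ := by simp
  smul_mem' c z hz j hj := by simp [hz j hj]

namespace IsTridiagonalEigenbasis

variable {A B : Module.End F V} {x : Fin (d + 1) → F} {v : Module.Basis (Fin (d + 1)) F V}

theorem repr_apply (h : IsTridiagonalEigenbasis A B x v) (z : V) (j : Fin (d + 1)) :
    v.repr (A z) j = x j * v.repr z j := by
  conv_lhs => rw [← v.sum_repr z]
  simp_rw [map_sum, map_smul, h.apply_eq, map_smul, v.repr_self]
  rw [Finsupp.finsetSum_apply, Finset.sum_eq_single j]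
  · simp [mul_comm]
  · intro i _ hi
    simp [Finsupp.single_eq_of_ne hi.symm]
  · simp

theorem repr_apply_eq_sum (B : Module.End F V) (v : Module.Basis (Fin (d + 1)) F V)
    (z : V) (j : Fin (d + 1)) :
    v.repr (B z) j = ∑ i, v.repr z i * v.repr (B (v i)) j := by
  conv_lhs => rw [← v.sum_repr z]
  simp_rw [map_sum, map_smul]
  rw [Finsupp.finsetSum_apply]
  simp

theorem apply_mem_lowSpace (h : IsTridiagonalEigenbasis A B x v) {n : ℕ} {z : V}
    (hz : z ∈ lowSpace v n) : B z ∈ lowSpace v (n + 1) := by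
  intro j hj
  rw [repr_apply_eq_sum]
  refine Finset.sum_eq_zero fun i _ => ?_
  by_cases hi : n ≤ i
  · rw [hz i hi, zero_mul]
  · rw [h.repr_eq_zero i j (by omega), mul_zero]

theorem apply_mem_highSpace (h : IsTridiagonalEigenbasis A B x v) {n : ℕ} {z : V}
    (hz : z ∈ highSpace v (n + 1)) : B z ∈ highSpace v n := by
  intro j hj
  rw [repr_apply_eq_sum]
  refine Finset.sum_eq_zero fun i _ => ?_
  by_cases hi : (i : ℕ) < n + 1
  · rw [hz i hi, zero_mul]
  · rw [h.repr_eq_zero i j (by omega), mul_zero]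

theorem sub_mem_lowSpace (h : IsTridiagonalEigenbasis A B x v) {n : ℕ} {z : V}
    (hz : z ∈ lowSpace v (n + 1)) : A z - extendNat x n • z ∈ lowSpace v n := by
  intro j hj
  rw [map_sub, map_smul, Finsupp.sub_apply, Finsupp.smul_apply, h.repr_apply]
  rcases hj.eq_or_lt with rfl | hj
  · simp
  · simp [hz j hj]

theorem self_mem_lowSpace (h : IsTridiagonalEigenbasis A B x v) {n : ℕ} {z : V}
    (hz : z ∈ lowSpace v n) : A z ∈ lowSpace v n := by
  intro j hj
  rw [h.repr_apply, hz j hj, mul_zero]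

theorem sub_mem_highSpace (h : IsTridiagonalEigenbasis A B x v) {n : ℕ} {z : V}
    (hz : z ∈ highSpace v n) : A z - extendNat x n • z ∈ highSpace v (n + 1) := by
  intro j hj
  rw [map_sub, map_smul, Finsupp.sub_apply, Finsupp.smul_apply, h.repr_apply]
  rcases (Nat.lt_succ_iff.1 hj).eq_or_lt with rfl | hj
  · simp
  · simp [hz j hj]

variable {y : Fin (d + 1) → F} {w : Module.Basis (Fin (d + 1)) F V}

theorem splitVec_mem_lowSpace (hw : IsTridiagonalEigenbasis B A y w) (n : ℕ) :
    splitVec A (extendNat x) (w 0) n ∈ lowSpace w (n + 1) := by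
  induction n with
  | zero =>
    intro j hj
    rw [splitVec, w.repr_self, Finsupp.single_eq_of_ne]
    rintro rfl; simp at hj
  | succ n ih =>
    exact sub_mem (hw.apply_mem_lowSpace ih)
      (Submodule.smul_mem _ _ fun j hj => ih j (by omega))

theorem splitVec_mem_highSpace (hv : IsTridiagonalEigenbasis A B x v) (z : V) (n : ℕ) :
    splitVec A (extendNat x) z n ∈ highSpace v n := by
  induction n with
  | zero => intro j hj; omega
  | succ n ih => exact hv.sub_mem_highSpace ih

theorem splitVec_eq_zero (hv : IsTridiagonalEigenbasis A B x v) (z : V) {n : ℕ} (hn : d < n) :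
    splitVec A (extendNat x) z n = 0 := by
  have h := hv.splitVec_mem_highSpace z n
  refine v.ext_elem fun j => ?_
  rw [h j (by omega)]; simp

/-- Irreducibility enters here: if the `n`th split vector had no component along `w n`, the span of
`w 0, …, w (n - 1)` would be a proper nonzero subspace invariant under both maps. -/
theorem span_splitVec_eq_lowSpace (hw : IsTridiagonalEigenbasis B A y w)
    (irr : ∀ W : Submodule F V, W.map A ≤ W → W.map B ≤ W → W = ⊥ ∨ W = ⊤) {n : ℕ}
    (hn : n ≤ d + 1) :
    Submodule.span F (splitVec A (extendNat x) (w 0) '' Set.Iio n) = lowSpace w n := by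
  set u := splitVec A (extendNat x) (w 0) with hu
  induction n with
  | zero =>
    have h0 : Set.Iio (0 : ℕ) = ∅ := by ext; simp
    rw [h0, Set.image_empty, Submodule.span_empty]
    refine le_antisymm bot_le fun z hz => ?_
    rw [Submodule.mem_bot]
    refine w.ext_elem fun j => ?_
    rw [hz j (by omega)]; simp
  | succ n ih =>
    have ih := ih (by omega)
    have hlow := hw.splitVec_mem_lowSpace (x := x) n
    rw [← hu] at hlow
    refine le_antisymm (Submodule.span_le.2 ?_) fun z hz => ?_
    · rintro _ ⟨i, hi, rfl⟩ j hj
      exact hw.splitVec_mem_lowSpace i j (by have := Set.mem_Iio.1 hi; omega)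
    have hc : w.repr (u n) ⟨n, by omega⟩ ≠ 0 := by
      intro hc
      have hun : u n ∈ lowSpace w n := by
        intro j hj
        rcases hj.eq_or_lt with hj | hj
        · rw [← hc]; congr 1; ext; simp [hj]
        · exact hlow j hj
      have hn0 : n ≠ 0 := by
        rintro rfl
        have : w.repr (w 0) (0 : Fin (d + 1)) = 0 := hc
        simp at this
      have hAinv : (lowSpace w n).map A ≤ lowSpace w n := by
        conv_lhs => rw [← ih]
        rw [Submodule.map_span_le]
        rintro _ ⟨i, hi, rfl⟩
        have hi := Set.mem_Iio.1 hi
        have hAu : A (u i) = u (i + 1) + extendNat x i • u i := by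
          simp [hu, splitVec]
        rw [hAu]
        refine add_mem ?_ (Submodule.smul_mem _ _ (ih ▸ Submodule.subset_span ⟨i, hi, rfl⟩))
        by_cases h : i + 1 = n
        · rw [h]; exact hun
        · rw [← ih]; exact Submodule.subset_span ⟨i + 1, Set.mem_Iio.2 (by omega), rfl⟩
      have hBinv : (lowSpace w n).map B ≤ lowSpace w n := by
        rintro _ ⟨z, hz, rfl⟩
        exact hw.self_mem_lowSpace hz
      rcases irr (lowSpace w n) hAinv hBinv with hbot | htop
      · have : w 0 ∈ lowSpace w n := by
          intro j hj
          rw [w.repr_self, Finsupp.single_eq_of_ne]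
          rintro rfl; simp at hj; omega
        rw [hbot, Submodule.mem_bot] at this
        exact w.ne_zero 0 this
      · have : w ⟨n, by omega⟩ ∈ lowSpace w n := by rw [htop]; trivial
        have := this ⟨n, by omega⟩ le_rfl
        simp at this
    set c := w.repr (u n) ⟨n, by omega⟩ with hcdef
    set e := w.repr z ⟨n, by omega⟩ / c with he
    have hz' : z - e • u n ∈ lowSpace w n := by
      intro j hj
      rw [map_sub, map_smul, Finsupp.sub_apply, Finsupp.smul_apply]
      rcases hj.eq_or_lt with hj | hj
      · have : j = ⟨n, by omega⟩ := by ext; simp [hj]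
        rw [this, ← hcdef, he, smul_eq_mul, div_mul_cancel₀ _ hc, sub_self]
      · rw [hz j hj, hlow j hj]; simp
    rw [← ih] at hz'
    have : z = (z - e • u n) + e • u n := by simp
    rw [this]
    refine add_mem (Submodule.span_mono (Set.image_mono (Set.Iio_subset_Iio n.le_succ)) hz')
      (Submodule.smul_mem _ _ (Submodule.subset_span ⟨n, by simp, rfl⟩))

/-- Comparing `f k (A (v j))` computed in two ways, induction on `k` gives `f k (v j) = 0` for `j >
k`, since the eigenvalues are distinct. -/
theorem dual_family_eq_zero (hv : IsTridiagonalEigenbasis A B x v)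
    {u : ℕ → V} {f : ℕ → Module.Dual F V}
    (hf : ∀ k j, k ≤ d → f k (u j) = if j = k then 1 else 0)
    (hs : ∀ z, z = ∑ k ∈ Finset.range (d + 1), f k z • u k)
    (hA : ∀ i ≤ d, A (u i) = extendNat x i • u i + u (i + 1)) {n k : ℕ} (hk : k < n) (hkd : k ≤ d)
    {z : V} (hz : z ∈ highSpace v n) : f k z = 0 := by
  have key : ∀ k ≤ d, ∀ j : Fin (d + 1), k < j → f k (v j) = 0 := by
    intro k hkd
    induction k with
    | zero =>
      intro j hj
      have h := (dual_family_raise hf hs hA (v j)).1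
      rw [hv.apply_eq, map_smul, smul_eq_mul, ← extendNat_val x j] at h
      have hne : extendNat x j - extendNat x 0 ≠ 0 := fun hh => by
        have := extendNat_injOn hv.inj (by omega) (by omega) (sub_eq_zero.1 hh)
        omega
      refine (mul_eq_zero.1 ?_).resolve_left hne
      linear_combination h
    | succ k ih =>
      intro j hj
      have h := (dual_family_raise hf hs hA (v j)).2 k hkd
      rw [hv.apply_eq, map_smul, smul_eq_mul, ← extendNat_val x j, ih (by omega) j (by omega)] at h
      have hne : extendNat x j - extendNat x (k + 1) ≠ 0 := fun hh => by
        have := extendNat_injOn hv.inj (by omega) (by omega) (sub_eq_zero.1 hh)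
        omega
      refine (mul_eq_zero.1 ?_).resolve_left hne
      linear_combination h
  rw [← v.sum_repr z, map_sum]
  refine Finset.sum_eq_zero fun j _ => ?_
  rw [map_smul]
  by_cases hj : (j : ℕ) < n
  · rw [hz j hj, zero_smul]
  · rw [key k hkd j (by omega), smul_zero]

/-- The vector `B (u (i + 1))`, minus its diagonal part, lies in the span of `w 0, …, w i` and in
that of `v i, …, v d`. The first kills its coordinates above `i`, the second those below `i`,
leaving a multiple of `u i`. -/
theorem exists_isSplitBasis (hv : IsTridiagonalEigenbasis A B x v)
    (hw : IsTridiagonalEigenbasis B A y w)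
    (irr : ∀ W : Submodule F V, W.map A ≤ W → W.map B ≤ W → W = ⊥ ∨ W = ⊤) :
    ∃ φ u, IsSplitBasis d A B (extendNat x) (extendNat y) φ u := by
  set u := splitVec A (extendNat x) (w 0) with hu
  have hrange : (Set.range fun i : Fin (d + 1) => u i) = u '' Set.Iio (d + 1) := by
    ext z
    constructor
    · rintro ⟨i, rfl⟩; exact ⟨i, i.isLt, rfl⟩
    · rintro ⟨i, hi, rfl⟩; exact ⟨⟨i, hi⟩, rfl⟩
  have hsp : ⊤ ≤ Submodule.span F (Set.range fun i : Fin (d + 1) => u i) := by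
    rw [hrange, hu, hw.span_splitVec_eq_lowSpace irr le_rfl]
    intro z _ j hj
    omega
  have li : LinearIndependent F fun i : Fin (d + 1) => u i :=
    linearIndependent_of_top_le_span_of_card_eq_finrank hsp
      (Module.finrank_eq_card_basis w).symm
  have h0 : ∀ i, d < i → u i = 0 := fun i hi => hv.splitVec_eq_zero _ hi
  have hA : ∀ i ≤ d, A (u i) = extendNat x i • u i + u (i + 1) := by
    intro i _
    simp [hu, splitVec]
  obtain ⟨f, hf, hs⟩ := exists_dual_family li hsp h0
  -- At `k = 0` the truncated subtraction yields an irrelevant value.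
  refine ⟨fun k => f (k - 1) (B (u k)), u, li, hsp, h0, hA, ?_, fun i hi => ?_⟩
  · have : u 0 = w 0 := rfl
    rw [this, hw.apply_eq]
    rfl
  · have hlow : B (u (i + 1)) - extendNat y (i + 1) • u (i + 1) ∈
        Submodule.span F (u '' Set.Iio (i + 1)) := by
      rw [hu, hw.span_splitVec_eq_lowSpace irr (by omega)]
      exact hw.sub_mem_lowSpace (hw.splitVec_mem_lowSpace _)
    have hle : ∀ k, i < k → k ≤ d → f k (B (u (i + 1)) - extendNat y (i + 1) • u (i + 1)) = 0 := by
      intro k hik hkd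
      have : Submodule.span F (u '' Set.Iio (i + 1)) ≤ LinearMap.ker (f k) := by
        rw [Submodule.span_le]
        rintro _ ⟨j, hj, rfl⟩
        have hj := Set.mem_Iio.1 hj
        simp [hf k j hkd]
        omega
      exact this hlow
    have hhigh : B (u (i + 1)) - extendNat y (i + 1) • u (i + 1) ∈ highSpace v i := by
      refine sub_mem (hv.apply_mem_highSpace (hv.splitVec_mem_highSpace _ _))
        (Submodule.smul_mem _ _ fun j hj => hv.splitVec_mem_highSpace _ _ j (by omega))
    rw [← sub_eq_iff_eq_add', hs (B (u (i + 1)) - extendNat y (i + 1) • u (i + 1)),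
      Finset.sum_eq_single i]
    · rw [map_sub, map_smul, hf i (i + 1) (by omega)]
      simp
    · intro k hk hki
      rcases lt_or_gt_of_ne hki with h | h
      · rw [hv.dual_family_eq_zero hf hs hA h (by omega) hhigh, zero_smul]
      · rw [hle k h (by simpa [Nat.lt_succ_iff] using hk), zero_smul]
    · simp; omega

end IsTridiagonalEigenbasis

end LeonardPairs

/-! ### The split sequence as a product of first split entries -/

section LeonardPairs

variable {F : Type*} [Field F] {V : Type*} [AddCommGroup V] [Module F V] {d : ℕ}

theorem prod_Iio_eq_prod_range {M : Type*} [CommMonoid M] (f : ℕ → M) (i : Fin (d + 1)) :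
    ∏ h ∈ Finset.Iio i, f h = ∏ n ∈ Finset.range i, f n := by
  have : Finset.range (i : ℕ) = Finset.Iio (i : ℕ) := by ext; simp
  rw [this, ← Fin.map_valEmbedding_Iio, Finset.prod_map]
  rfl

theorem prod_Ioc_zero_eq_prod_Icc {M : Type*} [CommMonoid M] (f : ℕ → M) (i : Fin (d + 1)) :
    ∏ h ∈ Finset.Ioc 0 i, f h = ∏ n ∈ Finset.Icc 1 (i : ℕ), f n := by
  have : Finset.Icc 1 (i : ℕ) = Finset.Ioc ((0 : Fin (d + 1)) : ℕ) i := by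
    ext; simp [Nat.succ_le_iff]
  rw [this, ← Fin.map_valEmbedding_Ioc, Finset.prod_map]
  rfl

namespace IsSplitBasis

variable {A B : Module.End F V} {x y φ : ℕ → F} {u : ℕ → V}

theorem ne_zero (h : IsSplitBasis d A B x y φ u) {i : ℕ} (hi : i ≤ d) : u i ≠ 0 :=
  h.li.ne_zero ⟨i, Nat.lt_succ_of_le hi⟩

theorem aeval_prod_raise (h : IsSplitBasis d A B x y φ u) {k : ℕ} (hk : k ≤ d) :
    aeval A (∏ n ∈ Finset.range k, (X - C (x n))) (u 0) = u k := by
  induction k with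
  | zero => simp
  | succ k ih =>
    rw [Finset.prod_range_succ, mul_comm, map_mul, Module.End.mul_apply, ih (by omega)]
    simp [h.raise k (by omega)]

theorem aeval_prod_lower (h : IsSplitBasis d A B x y φ u) {k : ℕ} (hk : k ≤ d) :
    aeval B (∏ n ∈ Finset.Icc 1 k, (X - C (y n))) (u k) =
      (∏ n ∈ Finset.Icc 1 k, φ n) • u 0 := by
  induction k with
  | zero => simp
  | succ k ih =>
    rw [Finset.prod_Icc_succ_top (by omega), Finset.prod_Icc_succ_top (by omega), map_mul,
      Module.End.mul_apply]
    have : aeval B (X - C (y (k + 1))) (u (k + 1)) = φ (k + 1) • u k := by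
      simp [h.lower k (by omega)]
    rw [this, map_smul, ih (by omega), smul_smul, mul_comm]

/-- The entry φ₀ plays no role in a split basis; setting it to 0 makes the third-difference relation
valid from index 0. -/
theorem update_zero (h : IsSplitBasis d A B x y φ u) :
    IsSplitBasis d A B x y (Function.update φ 0 0) u :=
  { h with lower := fun i hi => by simpa using h.lower i hi }

end IsSplitBasis

namespace TridiagonalSystem

theorem IsLeonardSystem.ddown {Φ : TridiagonalSystem F V d} (h : Φ.IsLeonardSystem) :
    Φ.ddown.IsLeonardSystem := h

/-- A nonzero eigenvector determines its eigenvalue, so the chosen scalars `th` and `thStar` agree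
with those of the eigenbases. -/
theorem IsLeonardSystem.exists_eigenbases {Φ : TridiagonalSystem F V d}
    (hL : Φ.IsLeonardSystem) :
    ∃ v w : Module.Basis (Fin (d + 1)) F V, IsTridiagonalEigenbasis Φ.A Φ.Astar Φ.th v ∧
      IsTridiagonalEigenbasis Φ.Astar Φ.A Φ.thStar w ∧
      (∀ i, LinearMap.range (Φ.E i) = Submodule.span F {v i}) ∧
      ∀ i, LinearMap.range (Φ.Estar i) = Submodule.span F {w i} := by
  obtain ⟨-, h1, h2⟩ := hL
  obtain ⟨x, v, hv, hrv, hev⟩ := Φ.standard.exists_eigenbasis Φ.pair.diag h1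
  obtain ⟨y, w, hw, hrw, hew⟩ := Φ.standard_star.exists_eigenbasis Φ.pair.diag_star h2
  have hx : Φ.th = x := by
    funext i
    have hs : LinearMap.range (Φ.E i) = Φ.A.eigenspace (Φ.th i) :=
      Classical.epsilon_spec (p := fun z => LinearMap.range (Φ.E i) = Φ.A.eigenspace z)
        ⟨x i, hev i⟩
    have hm : v i ∈ Φ.A.eigenspace (Φ.th i) := by
      rw [← hs, hrv]; exact Submodule.mem_span_singleton_self _
    rw [Module.End.mem_eigenspace_iff, hv.apply_eq] at hm
    exact (smul_left_injective F (v.ne_zero i) hm).symm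
  have hy : Φ.thStar = y := by
    funext i
    have hs : LinearMap.range (Φ.Estar i) = Φ.Astar.eigenspace (Φ.thStar i) :=
      Classical.epsilon_spec (p := fun z => LinearMap.range (Φ.Estar i) = Φ.Astar.eigenspace z)
        ⟨y i, hew i⟩
    have hm : w i ∈ Φ.Astar.eigenspace (Φ.thStar i) := by
      rw [← hs, hrw]; exact Submodule.mem_span_singleton_self _
    rw [Module.End.mem_eigenspace_iff, hw.apply_eq] at hm
    exact (smul_left_injective F (w.ne_zero i) hm).symm
  rw [hx, hy]
  exact ⟨v, w, hv, hw, hrv, hrw⟩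

theorem isSplitForm_of_isSplitBasis {Φ : TridiagonalSystem F V d} {φ : ℕ → F} {u : ℕ → V}
    (h : IsSplitBasis d Φ.A Φ.Astar (extendNat Φ.th) (extendNat Φ.thStar) φ u) :
    Φ.IsSplitForm φ := by
  let b := Module.Basis.mk h.li h.span
  have hb (i : Fin (d + 1)) : b i = u i := by simp [b]
  have hb' (n : ℕ) (hn : n < d + 1) : u n = b ⟨n, hn⟩ := (hb ⟨n, hn⟩).symm
  refine ⟨b, ?_, ?_⟩
  · ext i j
    rw [LinearMap.toMatrix_apply, Matrix.of_apply, hb, h.raise j (by omega), extendNat_val, map_add,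
      map_smul, Finsupp.add_apply, Finsupp.smul_apply, ← hb, b.repr_self, Finsupp.single_apply]
    by_cases hj : (j : ℕ) + 1 < d + 1
    · rw [hb' _ hj, b.repr_self, Finsupp.single_apply]
      simp only [Fin.ext_iff]
      split_ifs <;> first | contradiction | omega | (simp; done) |
        (simp; exact congrArg Φ.th (Fin.ext (by omega)))
    · rw [h.eq_zero _ (by omega)]
      simp only [Fin.ext_iff]
      split_ifs <;> first | contradiction | omega | (simp; done) |
        (simp; exact congrArg Φ.th (Fin.ext (by omega)))
  · ext i j
    rw [LinearMap.toMatrix_apply, Matrix.of_apply, hb]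
    obtain ⟨j, hj⟩ := j
    cases j with
    | zero =>
      simp only
      rw [h.lower_zero, hb' 0 hj, map_smul, Finsupp.smul_apply, b.repr_self, Finsupp.single_apply,
        extendNat_of_lt _ hj]
      simp only [Fin.ext_iff]
      split_ifs <;> first | contradiction | omega | (simp; done) |
        (simp; exact congrArg Φ.thStar (Fin.ext (by rw [Fin.val_zero]; omega)))
    | succ j =>
      simp only
      rw [h.lower j (by omega), hb' _ hj, hb' j (by omega), map_add, map_smul, map_smul,
        Finsupp.add_apply, Finsupp.smul_apply, Finsupp.smul_apply, b.repr_self, b.repr_self,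
        Finsupp.single_apply, Finsupp.single_apply, extendNat_of_lt _ hj]
      simp only [Fin.ext_iff]
      split_ifs <;> first | contradiction | omega | (simp; done) |
        (simp; exact congrArg Φ.thStar (Fin.ext (by omega)))

theorem IsSplitForm.exists_isSplitBasis {Φ : TridiagonalSystem F V d} {φ : ℕ → F}
    (h : Φ.IsSplitForm φ) :
    ∃ u, IsSplitBasis d Φ.A Φ.Astar (extendNat Φ.th) (extendNat Φ.thStar) φ u := by
  obtain ⟨b, hA, hB⟩ := h
  have hA' (i j : Fin (d + 1)) := congrFun (congrFun hA i) j
  have hB' (i j : Fin (d + 1)) := congrFun (congrFun hB i) j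
  simp only [LinearMap.toMatrix_apply, Matrix.of_apply] at hA' hB'
  let u : ℕ → V := fun n => if hn : n < d + 1 then b ⟨n, hn⟩ else 0
  have hu (n : ℕ) (hn : n < d + 1) : u n = b ⟨n, hn⟩ := dif_pos hn
  have hu0 (n : ℕ) (hn : d < n) : u n = 0 := dif_neg (by omega)
  have hub : (fun i : Fin (d + 1) => u i) = b := by
    funext i; exact hu i i.isLt
  refine ⟨u, by rw [hub]; exact b.linearIndependent, by rw [hub]; exact b.span_eq.ge, hu0, ?_, ?_,
    ?_⟩
  · intro j hj
    rw [hu j (by omega), extendNat_of_lt _ (Nat.lt_succ_of_le hj)]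
    refine b.ext_elem fun i => ?_
    rw [hA', map_add, map_smul, Finsupp.add_apply, Finsupp.smul_apply, b.repr_self,
      Finsupp.single_apply]
    by_cases hj : j + 1 < d + 1
    · rw [hu _ hj, b.repr_self, Finsupp.single_apply]
      simp only [Fin.ext_iff]
      split_ifs <;> first | contradiction | omega | (simp; done) |
        (simp; exact congrArg Φ.th (Fin.ext (by omega)))
    · rw [hu0 _ (by omega)]
      simp only [Fin.ext_iff]
      split_ifs <;> first | contradiction | omega | (simp; done) |
        (simp; exact congrArg Φ.th (Fin.ext (by omega)))
  · rw [hu 0 (by omega), extendNat_of_lt _ (Nat.succ_pos d)]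
    refine b.ext_elem fun i => ?_
    rw [hB', map_smul, Finsupp.smul_apply, b.repr_self, Finsupp.single_apply]
    simp only [Fin.ext_iff]
    split_ifs <;> first | contradiction | omega | (simp; done) |
        (simp; exact congrArg Φ.thStar (Fin.ext (by rw [Fin.val_zero]; omega)))
  · intro j hj
    rw [hu j (by omega), hu (j + 1) (by omega), extendNat_of_lt _ (Nat.succ_lt_succ hj)]
    refine b.ext_elem fun i => ?_
    rw [hB', map_add, map_smul, map_smul, Finsupp.add_apply, Finsupp.smul_apply,
      Finsupp.smul_apply, b.repr_self, b.repr_self, Finsupp.single_apply, Finsupp.single_apply]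
    simp only [Fin.ext_iff]
    split_ifs <;> first | contradiction | omega | (simp; done) |
        (simp; exact congrArg Φ.thStar (Fin.ext (by omega)))

theorem IsLeonardSystem.exists_isSplitBasis_firstSplit {Φ : TridiagonalSystem F V d}
    (hL : Φ.IsLeonardSystem) :
    ∃ u, IsSplitBasis d Φ.A Φ.Astar (extendNat Φ.th) (extendNat Φ.thStar) Φ.firstSplit u := by
  obtain ⟨v, w, hv, hw, -, -⟩ := hL.exists_eigenbases
  obtain ⟨φ, u, hu⟩ := hv.exists_isSplitBasis hw Φ.pair.irreducible
  have : Φ.IsSplitForm Φ.firstSplit :=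
    Classical.epsilon_spec (p := fun φ : ℕ → F => Φ.IsSplitForm φ)
      ⟨φ, isSplitForm_of_isSplitBasis hu⟩
  exact this.exists_isSplitBasis

/-- The space `U₀` is the line through `u 0`: the sum of all `E j V` is everything, and `u 0` is an
eigenvector of `A*` for θ*₀. The `A`-factors carry `u 0` to `u i`, and the `A*`-factors bring it
back, one φ per step. -/
theorem IsLeonardSystem.splitSeq_eq {Φ : TridiagonalSystem F V d} (hL : Φ.IsLeonardSystem)
    (i : Fin (d + 1)) : Φ.splitSeq i = ∏ k ∈ Finset.Icc 1 (i : ℕ), Φ.firstSplit k := by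
  obtain ⟨v, w, hv, hw, hrv, hrw⟩ := hL.exists_eigenbases
  obtain ⟨u, hu⟩ := hL.exists_isSplitBasis_firstSplit
  have hspace : Φ.splitSpace 0 = Submodule.span F {w 0} := by
    have h1 : (⨆ j ∈ Set.Iic (0 : Fin (d + 1)), LinearMap.range (Φ.Estar j)) =
        Submodule.span F {w 0} := by
      refine le_antisymm (iSup₂_le fun j hj => ?_) ?_
      · rw [Fin.le_zero_iff.1 (Set.mem_Iic.1 hj), hrw]
      · rw [← hrw]
        exact le_iSup₂_of_le (f := fun (j : Fin (d + 1)) (_ : j ∈ Set.Iic (0 : Fin (d + 1))) =>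
          LinearMap.range (Φ.Estar j)) 0 (Set.mem_Iic.2 le_rfl) le_rfl
    have h2 : (⨆ j ∈ Set.Ici (0 : Fin (d + 1)), LinearMap.range (Φ.E j)) = ⊤ := by
      rw [eq_top_iff, ← v.span_eq, Submodule.span_le]
      rintro _ ⟨j, rfl⟩
      have hj : v j ∈ LinearMap.range (Φ.E j) := by
        rw [hrv]; exact Submodule.mem_span_singleton_self _
      exact le_iSup₂_of_le (f := fun (j : Fin (d + 1)) (_ : j ∈ Set.Ici (0 : Fin (d + 1))) =>
          LinearMap.range (Φ.E j)) j (Set.mem_Ici.2 (Fin.zero_le j)) le_rfl hj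
    rw [splitSpace, h1, h2, inf_top_eq]
  have huw : u 0 ∈ Submodule.span F {w 0} := by
    have h0 (j : Fin (d + 1)) (hj : j ≠ 0) : w.repr (u 0) j = 0 := by
      have h := hw.repr_apply (u 0) j
      rw [hu.lower_zero, map_smul, Finsupp.smul_apply, smul_eq_mul] at h
      have hne : extendNat Φ.thStar 0 - Φ.thStar j ≠ 0 := fun hh =>
        hj (hw.inj (sub_eq_zero.1 hh)).symm
      refine (mul_eq_zero.1 ?_).resolve_left hne
      linear_combination h
    rw [← w.sum_repr (u 0), Finset.sum_eq_single 0]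
    · exact Submodule.smul_mem _ _ (Submodule.mem_span_singleton_self _)
    · intro j _ hj
      rw [h0 j hj, zero_smul]
    · simp
  obtain ⟨c, hc⟩ := Submodule.mem_span_singleton.1 huw
  have hu0 : u 0 ≠ 0 := hu.ne_zero (Nat.zero_le d)
  have hc0 : c ≠ 0 := by
    rintro rfl
    exact hu0 (by rw [← hc, zero_smul])
  have hspan : Φ.splitSpace 0 = Submodule.span F {u 0} := by
    rw [hspace, ← hc, Submodule.span_singleton_smul_eq (IsUnit.mk0 c hc0)]
  have hop : Φ.splitOperator i (u 0) = (∏ k ∈ Finset.Icc 1 (i : ℕ), Φ.firstSplit k) • u 0 := by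
    have e1 := prod_Iio_eq_prod_range (fun n => X - C (extendNat Φ.th n)) i
    have e2 := prod_Ioc_zero_eq_prod_Icc (fun n => X - C (extendNat Φ.thStar n)) i
    simp only [extendNat_val] at e1 e2
    rw [splitOperator, e1, e2, Module.End.mul_apply, hu.aeval_prod_raise (by omega),
      hu.aeval_prod_lower (by omega)]
  have hex : ∀ z ∈ Φ.splitSpace 0,
      Φ.splitOperator i z = (∏ k ∈ Finset.Icc 1 (i : ℕ), Φ.firstSplit k) • z := by
    intro z hz
    rw [hspan] at hz
    obtain ⟨e, rfl⟩ := Submodule.mem_span_singleton.1 hz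
    rw [map_smul, hop, smul_comm]
  have hs : ∀ z ∈ Φ.splitSpace 0, Φ.splitOperator i z = Φ.splitSeq i • z :=
    Classical.epsilon_spec
      (p := fun c : F => ∀ z ∈ Φ.splitSpace 0, Φ.splitOperator i z = c • z) ⟨_, hex⟩
  have := hs (u 0) (by rw [hspan]; exact Submodule.mem_span_singleton_self _)
  rw [hop] at this
  exact (smul_left_injective F hu0 this).symm

end TridiagonalSystem

end LeonardPairs

/-! ### The tridiagonal relation and corner entries -/

section LeonardPairs

variable {F : Type*} [Field F] {V : Type*} [AddCommGroup V] [Module F V] {d : ℕ}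

variable {A B : Module.End F V}

/-- In the eigenbasis of `A`, the (j, i) entry of the left side is that of `B` times the polynomial
in `hp`. That polynomial vanishes near the diagonal, and the entry of `B` vanishes elsewhere. -/
theorem IsTridiagonalEigenbasis.tridiagonal_relation {x : Fin (d + 1) → F}
    {v : Module.Basis (Fin (d + 1)) F V} (hv : IsTridiagonalEigenbasis A B x v) {γ ρ : F}
    (hp : ∀ i j : Fin (d + 1), (j : ℕ) ≤ (i : ℕ) + 1 → (i : ℕ) ≤ (j : ℕ) + 1 →
      (x j - x i) ^ 3 - γ * (x j ^ 2 - x i ^ 2) - ρ * (x j - x i) = 0) (z : V) :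
    A (A (A (B z))) - (3 : F) • A (A (B (A z))) + (3 : F) • A (B (A (A z))) - B (A (A (A z))) -
      γ • (A (A (B z)) - B (A (A z))) - ρ • (A (B z) - B (A z)) = 0 := by
  have h : A * A * A * B - (3 : F) • (A * A * B * A) + (3 : F) • (A * B * A * A) - B * A * A * A -
      γ • (A * A * B - B * A * A) - ρ • (A * B - B * A) = 0 := by
    refine v.ext fun i => v.ext_elem fun j => ?_
    simp only [LinearMap.sub_apply, LinearMap.add_apply, LinearMap.smul_apply, Module.End.mul_apply,
      hv.apply_eq, map_sub, map_add, map_smul, Finsupp.sub_apply, Finsupp.add_apply,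
      Finsupp.smul_apply, hv.repr_apply, smul_eq_mul, LinearMap.zero_apply, map_zero,
      Finsupp.zero_apply]
    by_cases hij : (j : ℕ) ≤ (i : ℕ) + 1 ∧ (i : ℕ) ≤ (j : ℕ) + 1
    · linear_combination v.repr (B (v i)) j * hp i j hij.1 hij.2
    · rw [hv.repr_eq_zero i j hij]; ring
  simpa using LinearMap.congr_fun h z

namespace IsSplitBasis

variable {x y φ : ℕ → F} {u : ℕ → V}

/-- This is the coefficient of `u (i + 2)` in the relation applied to `u i`. -/
theorem third_difference (h : IsSplitBasis d A B x y φ u) (h0 : φ 0 = 0) {γ ρ : F}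
    (hR : ∀ z, A (A (A (B z))) - (3 : F) • A (A (B (A z))) + (3 : F) • A (B (A (A z))) -
      B (A (A (A z))) - γ • (A (A (B z)) - B (A (A z))) - ρ • (A (B z) - B (A z)) = 0)
    {i : ℕ} (hi : i + 3 ≤ d) :
    φ i - 3 * φ (i + 1) + 3 * φ (i + 2) - φ (i + 3) +
      y i * (x i + x (i + 1) + x (i + 2)) - 3 * (y i * x i + y (i + 1) * (x (i + 1) + x (i + 2))) +
      3 * (y (i + 1) * (x i + x (i + 1)) + y (i + 2) * x (i + 2)) -
      y (i + 2) * (x i + x (i + 1) + x (i + 2)) - γ * (y i - y (i + 2)) = 0 := by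
  obtain ⟨f, hf, -⟩ := exists_dual_family h.li h.span h.eq_zero
  -- Here `z` stands for φᵢ uᵢ₋₁, and for 0 when i = 0, so that both cases share one computation; i
  -- = 0 is where `h0` is needed.
  obtain ⟨z, τ, hBz, hAz, hfz⟩ : ∃ (z : V) (τ : F), B (u i) = y i • u i + z ∧
      A z = τ • z + φ i • u i ∧ f (i + 2) z = 0 := by
    cases i with
    | zero => exact ⟨0, 0, by rw [h.lower_zero, add_zero], by simp [h0], by simp⟩
    | succ i =>
      refine ⟨φ (i + 1) • u i, x i, h.lower i (by omega), ?_, ?_⟩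
      · rw [map_smul, h.raise i (by omega), smul_add, smul_comm]
      · rw [map_smul, hf _ _ (by omega), if_neg (by omega), smul_zero]
  have hA0 := h.raise i (by omega)
  have hA1 : A (u (i + 1)) = x (i + 1) • u (i + 1) + u (i + 2) := h.raise (i + 1) (by omega)
  have hA2 : A (u (i + 2)) = x (i + 2) • u (i + 2) + u (i + 3) := h.raise (i + 2) (by omega)
  have hB1 := h.lower i (by omega)
  have hB2 : B (u (i + 2)) = y (i + 2) • u (i + 2) + φ (i + 2) • u (i + 1) :=
    h.lower (i + 1) (by omega)
  have hB3 : B (u (i + 3)) = y (i + 3) • u (i + 3) + φ (i + 3) • u (i + 2) :=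
    h.lower (i + 2) (by omega)
  have f0 : f (i + 2) (u i) = 0 := by rw [hf _ _ (by omega), if_neg (by omega)]
  have f1 : f (i + 2) (u (i + 1)) = 0 := by rw [hf _ _ (by omega), if_neg (by omega)]
  have f2 : f (i + 2) (u (i + 2)) = 1 := by rw [hf _ _ (by omega), if_pos rfl]
  have f3 : f (i + 2) (u (i + 3)) = 0 := by rw [hf _ _ (by omega), if_neg (by omega)]
  have key := congrArg (f (i + 2)) (hR (u i))
  simp only [hBz, hAz, hA0, hA1, hA2, hB1, hB2, hB3, map_add, map_sub, map_smul, f0, f1, f2, f3,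
    hfz, smul_eq_mul, map_zero] at key
  norm_num at key
  linear_combination key

variable {n : ℕ}

/-- The vector `u 0` is a multiple of `w 0`, so the corner entry of `A` can be read from `A (u 0)`
and `B (u 1)`. That entry does not depend on how the eigenspaces of `A` are ordered, which allows
comparison with `Φ^⇓`. -/
theorem mul_repr_zero_zero (h : IsSplitBasis d A B x y φ u) (hd : 1 ≤ d)
    {w : Module.Basis (Fin (d + 1)) F V} {y' : Fin (d + 1) → F} (hy : extendNat y' = y)
    (hw : IsTridiagonalEigenbasis B A y' w) :
    (y 0 - y 1) * w.repr (A (w 0)) 0 = (y 0 - y 1) * x 0 + φ 1 := by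
  subst hy
  have hne (j : Fin (d + 1)) (hj : j ≠ 0) : w.repr (u 0) j = 0 := by
    have h1 := hw.repr_apply (u 0) j
    rw [h.lower_zero, map_smul, Finsupp.smul_apply, smul_eq_mul] at h1
    have hne : extendNat y' 0 - y' j ≠ 0 := fun hh => hj (hw.inj (sub_eq_zero.1 hh)).symm
    refine (mul_eq_zero.1 ?_).resolve_left hne
    linear_combination h1
  have hu : u 0 = w.repr (u 0) 0 • w 0 := by
    conv_lhs => rw [← w.sum_repr (u 0)]
    rw [Finset.sum_eq_single 0]
    · intro j _ hj
      rw [hne j hj, zero_smul]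
    · simp
  have hc : w.repr (u 0) 0 ≠ 0 := by
    intro hc
    rw [hc, zero_smul] at hu
    exact h.li.ne_zero (0 : Fin (d + 1)) hu
  have e1 := congrArg (fun z => w.repr z 0) (h.lower 0 (by omega))
  have e2 := congrArg (fun z => w.repr z 0) (h.raise 0 (by omega))
  have e3 := congrArg (fun z => w.repr (A z) 0) hu
  simp only [hw.repr_apply, map_add, map_smul, Finsupp.add_apply, Finsupp.smul_apply,
    smul_eq_mul, zero_add] at e1 e2 e3
  have hy0 : y' 0 = extendNat y' 0 := rfl
  rw [hy0] at e1
  refine mul_left_cancel₀ hc ?_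
  linear_combination e1 + (extendNat y' 0 - extendNat y' 1) * (e2 - e3)

/-- Same idea at the other end: the last split vector is an eigenvector of `A`, hence a multiple of
the last `v`. -/
theorem mul_repr_last_last (h : IsSplitBasis (n + 1) A B x y φ u)
    {v : Module.Basis (Fin (n + 2)) F V} {x' : Fin (n + 2) → F} (hx : extendNat x' = x)
    (hv : IsTridiagonalEigenbasis A B x' v) :
    (x (n + 1) - x n) * v.repr (B (v (Fin.last (n + 1)))) (Fin.last (n + 1)) =
      (x (n + 1) - x n) * y (n + 1) + φ (n + 1) := by
  subst hx
  set l := Fin.last (n + 1) with hl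
  have hxl : x' l = extendNat x' (n + 1) := (extendNat_val x' l).symm
  have hAu := h.raise (n + 1) le_rfl
  rw [h.eq_zero _ (Nat.lt_succ_self _), add_zero] at hAu
  have hne (j : Fin (n + 2)) (hj : j ≠ l) : v.repr (u (n + 1)) j = 0 := by
    have h1 := hv.repr_apply (u (n + 1)) j
    rw [hAu, map_smul, Finsupp.smul_apply, smul_eq_mul, ← hxl] at h1
    have hne : x' l - x' j ≠ 0 := fun hh => hj (hv.inj (sub_eq_zero.1 hh)).symm
    refine (mul_eq_zero.1 ?_).resolve_left hne
    linear_combination h1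
  have hu : u (n + 1) = v.repr (u (n + 1)) l • v l := by
    conv_lhs => rw [← v.sum_repr (u (n + 1))]
    rw [Finset.sum_eq_single l]
    · intro j _ hj
      rw [hne j hj, zero_smul]
    · simp
  have hc : v.repr (u (n + 1)) l ≠ 0 := by
    intro hc
    rw [hc, zero_smul] at hu
    exact h.li.ne_zero l hu
  have e1 := congrArg (fun z => v.repr z l) (h.lower n (by omega))
  have e2 := congrArg (fun z => v.repr z l) (h.raise n (by omega))
  have e3 := congrArg (fun z => v.repr (B z) l) hu
  simp only [hv.repr_apply, map_add, map_smul, Finsupp.add_apply, Finsupp.smul_apply,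
    smul_eq_mul, hxl] at e1 e2 e3
  refine mul_left_cancel₀ hc ?_
  linear_combination (extendNat x' (n + 1) - extendNat x' n) * (e1 - e3) + φ (n + 1) * e2

/-- The eigenvector `v 0` need not be a split vector, so the argument is dualized: `f 0` is a left
eigenvector of `A`, hence proportional to the coordinate along `v 0`. -/
theorem mul_repr_zero_zero' (h : IsSplitBasis d A B x y φ u) (hd : 1 ≤ d)
    {v : Module.Basis (Fin (d + 1)) F V} {x' : Fin (d + 1) → F} (hx : extendNat x' = x)
    (hv : IsTridiagonalEigenbasis A B x' v) :
    (x 0 - x 1) * v.repr (B (v 0)) 0 = (x 0 - x 1) * y 0 + φ 1 := by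
  subst hx
  obtain ⟨f, hf, hs⟩ := exists_dual_family h.li h.span h.eq_zero
  have hx0 : x' 0 = extendNat x' 0 := rfl
  have hne (j : Fin (d + 1)) (hj : j ≠ 0) : f 0 (v j) = 0 := by
    have h1 := (dual_family_raise hf hs h.raise (v j)).1
    rw [hv.apply_eq, map_smul, smul_eq_mul, ← hx0] at h1
    have hne : x' j - x' 0 ≠ 0 := fun hh => hj (hv.inj (sub_eq_zero.1 hh))
    refine (mul_eq_zero.1 ?_).resolve_left hne
    linear_combination h1
  have hfz (z : V) : f 0 z = v.repr z 0 * f 0 (v 0) := by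
    conv_lhs => rw [← v.sum_repr z]
    rw [map_sum, Finset.sum_eq_single 0]
    · simp
    · intro j _ hj
      rw [map_smul, hne j hj, smul_zero]
    · simp
  have hc : f 0 (v 0) ≠ 0 := by
    intro hc
    have h1 := hfz (u 0)
    rw [hc, mul_zero, hf 0 0 (by omega)] at h1
    simp at h1
  have e1 := (dual_family_raise hf hs h.raise (v 0)).2 0 hd
  rw [hv.apply_eq, map_smul, smul_eq_mul, hx0, zero_add] at e1
  have e2 : f 0 (B (v 0)) = y 0 * f 0 (v 0) + φ 1 * f 1 (v 0) := by
    have hBz : B (v 0) = ∑ k ∈ Finset.range (d + 1), f k (v 0) • B (u k) := by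
      conv_lhs => rw [hs (v 0)]
      simp only [map_sum, map_smul]
    rw [hBz, map_sum, Finset.sum_eq_add_of_mem 0 1]
    · rw [map_smul, map_smul, h.lower_zero, h.lower 0 (by omega)]
      simp only [map_add, map_smul, hf 0 _ (Nat.zero_le d), smul_eq_mul]
      simp [mul_comm]
    · simp
    · simp; omega
    · simp
    · intro k hk hk01
      obtain ⟨k, rfl⟩ := Nat.exists_eq_succ_of_ne_zero hk01.1
      have hk1 : k ≠ 0 := fun hh => hk01.2 (by simp [hh])
      rw [map_smul, Nat.succ_eq_add_one, h.lower k (by simpa using hk)]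
      simp [hf 0 _ (Nat.zero_le d), hk1]
  have e3 := hfz (B (v 0))
  refine mul_left_cancel₀ hc ?_
  linear_combination (extendNat x' 0 - extendNat x' 1) * (e2 - e3) + φ 1 * e1

end IsSplitBasis

end LeonardPairs

/-! ### Closed forms in type II -/

theorem exists_quadratic_of_third_difference {F : Type*} [Field F] (h2 : (2 : F) ≠ 0) (s : ℕ → F)
    (d : ℕ) (h : ∀ i, i + 3 ≤ d → s i - 3 * s (i + 1) + 3 * s (i + 2) - s (i + 3) = 0) :
    ∃ a b c : F, ∀ i ≤ d,
      s i = a + b * ((i : ℕ) - (d : F) / 2) + c * (i : ℕ) * ((d : F) - (i : ℕ)) := by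
  -- The second difference of i(d-i) is -2, whence the need to divide by 2.
  obtain ⟨c, hc⟩ : ∃ c, 2 * c = -(s 2 - 2 * s 1 + s 0) :=
    ⟨-(s 2 - 2 * s 1 + s 0) / 2, by field_simp⟩
  refine ⟨s 0 + (s 1 - s 0 - c * (d - 1)) * (d / 2), s 1 - s 0 - c * (d - 1), c, fun i => ?_⟩
  induction i using Nat.strong_induction_on with
  | _ i ih =>
    intro hi
    match i with
    | 0 => push_cast; ring
    | 1 => push_cast; ring
    | 2 => push_cast; linear_combination hc
    | i + 3 =>
      have e0 := ih i (by omega) (by omega)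
      have e1 := ih (i + 1) (by omega) (by omega)
      have e2 := ih (i + 2) (by omega) (by omega)
      push_cast at e0 e1 e2 ⊢
      linear_combination e0 - 3 * e1 + 3 * e2 - h i hi

theorem two_mul_eq_of_third_difference {R : Type*} [CommRing R] {e : ℕ → R} {d : ℕ}
    (h : ∀ i, i + 3 ≤ d → e i - 3 * e (i + 1) + 3 * e (i + 2) - e (i + 3) = 0) (h0 : e 0 = 0)
    (h1 : e 1 = 0) (i : ℕ) (hi : i ≤ d) : 2 * e i = i * (i - 1) * e 2 := by
  induction i using Nat.strong_induction_on with
  | _ i ih =>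
    match i with
    | 0 => simp [h0]
    | 1 => simp [h1]
    | 2 => push_cast; ring
    | i + 3 =>
      have e0 := ih i (by omega) (by omega)
      have e1 := ih (i + 1) (by omega) (by omega)
      have e2 := ih (i + 2) (by omega) (by omega)
      push_cast at e0 e1 e2 ⊢
      linear_combination e0 - 3 * e1 + 3 * e2 - 2 * h i hi

theorem extendNat_rev {F : Type*} {d : ℕ} (x : Fin (d + 1) → F) {n : ℕ}
    (h : n ≤ d) :
    extendNat (fun i => x i.rev) n = extendNat x (d - n) := by
  rw [extendNat_of_lt _ (Nat.lt_succ_of_le h), extendNat_of_lt x (by omega)]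
  congr 1; ext; simp

section LeonardPairs

variable {F : Type*} [Field F] {V : Type*} [AddCommGroup V] [Module F V] {d : ℕ}

theorem IsTridiagonalEigenbasis.rev {A B : Module.End F V} {x : Fin (d + 1) → F}
    {v : Module.Basis (Fin (d + 1)) F V} (h : IsTridiagonalEigenbasis A B x v) :
    IsTridiagonalEigenbasis A B (fun i => x i.rev) (v.reindex Fin.revPerm) where
  inj := h.inj.comp Fin.rev_injective
  apply_eq i := by simp [h.apply_eq]
  repr_eq_zero i j hij := by
    simp only [Module.Basis.reindex_apply, Module.Basis.repr_reindex_apply]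
    refine h.repr_eq_zero _ _ fun hh => hij ?_
    simp only [Fin.revPerm_symm, Fin.revPerm_apply, Fin.val_rev] at hh
    omega

namespace TridiagonalSystem

theorem IsTypeIIParam.ddown {Φ : TridiagonalSystem F V d} {a b c a' b' c' : F}
    (h2 : (2 : F) ≠ 0) (h : Φ.IsTypeIIParam a b c a' b' c') :
    Φ.ddown.IsTypeIIParam a (-b) c a' b' c' := by
  intro i
  refine ⟨?_, (h i).2⟩
  change Φ.th i.rev = _
  rw [(h i.rev).1, Fin.val_rev, Nat.cast_sub (by omega)]
  push_cast
  field_simp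
  ring

theorem IsTypeIIParam.extendNat_th {Φ : TridiagonalSystem F V d} {a b c a' b' c' : F}
    (h : Φ.IsTypeIIParam a b c a' b' c') {n : ℕ} (hn : n ≤ d) : extendNat Φ.th n =
      a + b * ((n : ℕ) - (d : F) / 2) + c * (n : ℕ) * ((d : F) - (n : ℕ)) := by
  rw [extendNat_of_lt _ (Nat.lt_succ_of_le hn), (h _).1]

theorem IsTypeIIParam.extendNat_thStar {Φ : TridiagonalSystem F V d} {a b c a' b' c' : F}
    (h : Φ.IsTypeIIParam a b c a' b' c') {n : ℕ} (hn : n ≤ d) : extendNat Φ.thStar n =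
      a' + b' * ((n : ℕ) - (d : F) / 2) + c' * (n : ℕ) * ((d : F) - (n : ℕ)) := by
  rw [extendNat_of_lt _ (Nat.lt_succ_of_le hn), (h _).2]

/-- If n were 0 in the field, the parametrization would give θₙ = θ₀. -/
theorem IsLeonardSystem.natCast_ne_zero {Φ : TridiagonalSystem F V d} (hL : Φ.IsLeonardSystem)
    {a b c a' b' c' : F} (h : Φ.IsTypeIIParam a b c a' b' c') {n : ℕ} (h0 : n ≠ 0) (hn : n ≤ d) :
    (n : F) ≠ 0 := by
  obtain ⟨v, w, hv, -⟩ := hL.exists_eigenbases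
  intro hz
  refine h0 (extendNat_injOn hv.inj hn (Nat.zero_le d) ?_)
  rw [h.extendNat_th hn, h.extendNat_th (Nat.zero_le d), hz]
  simp

theorem two_ne_zero_of_isTypeII {Φ : TridiagonalSystem F V d} (h : Φ.IsTypeII) : (2 : F) ≠ 0 :=
  Ring.two_ne_zero h.2

theorem IsLeonardSystem.exists_isTypeIIParam {Φ : TridiagonalSystem F V d}
    (hL : Φ.IsLeonardSystem) (hII : Φ.IsTypeII) :
    ∃ a b c a' b' c' : F, Φ.IsTypeIIParam a b c a' b' c' := by
  obtain ⟨v, w, hv, hw, -⟩ := hL.exists_eigenbases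
  have h2 := two_ne_zero_of_isTypeII hII
  have hx : ∀ i, i + 3 ≤ d → extendNat Φ.th i - 3 * extendNat Φ.th (i + 1) +
      3 * extendNat Φ.th (i + 2) - extendNat Φ.th (i + 3) = 0 := by
    intro i hi
    have h := (hII.1.1 i hi).1
    rw [← extendNat_of_lt Φ.th, ← extendNat_of_lt Φ.th, ← extendNat_of_lt Φ.th,
      ← extendNat_of_lt Φ.th, div_eq_iff] at h
    · linear_combination h
    · intro hh
      have := extendNat_injOn hv.inj (by omega) (by omega) (sub_eq_zero.1 hh)
      omega
  have hy : ∀ i, i + 3 ≤ d → extendNat Φ.thStar i - 3 * extendNat Φ.thStar (i + 1) +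
      3 * extendNat Φ.thStar (i + 2) - extendNat Φ.thStar (i + 3) = 0 := by
    intro i hi
    have h := (hII.1.1 i hi).2
    rw [← extendNat_of_lt Φ.thStar, ← extendNat_of_lt Φ.thStar, ← extendNat_of_lt Φ.thStar,
      ← extendNat_of_lt Φ.thStar, div_eq_iff] at h
    · linear_combination h
    · intro hh
      have := extendNat_injOn hw.inj (by omega) (by omega) (sub_eq_zero.1 hh)
      omega
  obtain ⟨a, b, c, h⟩ := exists_quadratic_of_third_difference h2 _ d hx
  obtain ⟨a', b', c', h'⟩ := exists_quadratic_of_third_difference h2 _ d hy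
  refine ⟨a, b, c, a', b', c', fun i => ⟨?_, ?_⟩⟩
  · rw [← extendNat_val Φ.th, h i (by omega)]
  · rw [← extendNat_val Φ.thStar, h' i (by omega)]

theorem IsLeonardSystem.firstSplit_one_sub_secondSplit_one {Φ : TridiagonalSystem F V d}
    (hL : Φ.IsLeonardSystem) (hd : 1 ≤ d) :
    Φ.firstSplit 1 - Φ.secondSplit 1 = (extendNat Φ.thStar 0 - extendNat Φ.thStar 1) *
      (extendNat Φ.th d - extendNat Φ.th 0) := by
  obtain ⟨v, w, hv, hw, -⟩ := hL.exists_eigenbases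
  obtain ⟨u, hu⟩ := hL.exists_isSplitBasis_firstSplit
  obtain ⟨u', hu'⟩ := hL.ddown.exists_isSplitBasis_firstSplit
  have e1 := hu.mul_repr_zero_zero hd rfl hw
  have e2 := hu'.mul_repr_zero_zero hd rfl hw
  have e3 : extendNat Φ.ddown.th 0 = extendNat Φ.th d := extendNat_rev Φ.th (Nat.zero_le d)
  change (extendNat Φ.thStar 0 - extendNat Φ.thStar 1) * w.repr (Φ.A (w 0)) 0 =
    (extendNat Φ.thStar 0 - extendNat Φ.thStar 1) * extendNat Φ.ddown.th 0 +
      Φ.secondSplit 1 at e2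
  rw [e3] at e2
  linear_combination e2 - e1

/-- The last diagonal entry of `A*` in the eigenbasis of `A` becomes the first one for `Φ^⇓`;
evaluating it both ways gives the identity. -/
theorem IsLeonardSystem.firstSplit_last_sub_secondSplit_one {n : ℕ}
    {Φ : TridiagonalSystem F V (n + 1)} (hL : Φ.IsLeonardSystem) :
    Φ.firstSplit (n + 1) - Φ.secondSplit 1 =
      (extendNat Φ.thStar 0 - extendNat Φ.thStar (n + 1)) *
        (extendNat Φ.th (n + 1) - extendNat Φ.th n) := by
  obtain ⟨v, w, hv, hw, -⟩ := hL.exists_eigenbases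
  obtain ⟨u, hu⟩ := hL.exists_isSplitBasis_firstSplit
  obtain ⟨u', hu'⟩ := hL.ddown.exists_isSplitBasis_firstSplit
  have e1 := hu.mul_repr_last_last rfl hv
  have e2 := hu'.mul_repr_zero_zero' (by omega) rfl hv.rev
  have e3 : extendNat Φ.ddown.th 0 = extendNat Φ.th (n + 1) :=
    extendNat_rev Φ.th (Nat.zero_le _)
  have e4 : extendNat Φ.ddown.th 1 = extendNat Φ.th n := extendNat_rev Φ.th (by omega)
  have e5 : (v.reindex Fin.revPerm).repr (Φ.Astar (v.reindex Fin.revPerm 0)) 0 =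
      v.repr (Φ.Astar (v (Fin.last (n + 1)))) (Fin.last (n + 1)) := by
    simp
  change (extendNat Φ.ddown.th 0 - extendNat Φ.ddown.th 1) *
    (v.reindex Fin.revPerm).repr (Φ.Astar (v.reindex Fin.revPerm 0)) 0 =
      (extendNat Φ.ddown.th 0 - extendNat Φ.ddown.th 1) * extendNat Φ.thStar 0 +
        Φ.secondSplit 1 at e2
  rw [e3, e4, e5] at e2
  linear_combination e2 - e1

/-- The difference between φ and the candidate has zero third differences and vanishes at 0 and, by
the choice of `S`, at 1. Twice it is therefore a multiple of i(i-1), and vanishing at i = d kills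
the multiple. -/
theorem IsLeonardSystem.exists_firstSplit_eq {Φ : TridiagonalSystem F V d}
    (hL : Φ.IsLeonardSystem) (h2 : (2 : F) ≠ 0) {a b c a' b' c' : F}
    (hp : Φ.IsTypeIIParam a b c a' b' c') :
    ∃ S : F, ∀ i, 1 ≤ i → i ≤ d → Φ.firstSplit i = i * ((d : F) - i + 1) *
      (S + (b * c' + c * b') * (i - ((d : F) + 1) / 2) - c * c' * (i - ((d : F) + 1) / 2) ^ 2) := by
  obtain _ | n := d
  · exact ⟨0, fun i h1 h2 => by omega⟩
  have hd0 : ((n + 1 : ℕ) : F) ≠ 0 := hL.natCast_ne_zero hp (by omega) le_rfl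
  obtain ⟨v, w, hv, hw, -⟩ := hL.exists_eigenbases
  obtain ⟨u, hu⟩ := hL.exists_isSplitBasis_firstSplit
  have hu := hu.update_zero
  set φ := Function.update Φ.firstSplit 0 0 with hφ
  have hφi (i : ℕ) (hi : 1 ≤ i) : Φ.firstSplit i = φ i := by
    rw [hφ, Function.update_of_ne (by omega)]
  set D : F := ((n + 1 : ℕ) : F) with hD
  have hDn : D = n + 1 := by rw [hD]; push_cast; rfl
  obtain ⟨S, hS⟩ : ∃ S : F, φ 1 = D *
      (S + (b * c' + c * b') * (1 - (D + 1) / 2) - c * c' * (1 - (D + 1) / 2) ^ 2) := by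
    refine ⟨φ 1 / D - (b * c' + c * b') * (1 - (D + 1) / 2) + c * c' * (1 - (D + 1) / 2) ^ 2, ?_⟩
    field_simp
    ring
  set g : ℕ → F := fun i => i * (D - i + 1) *
      (S + (b * c' + c * b') * (i - (D + 1) / 2) - c * c' * (i - (D + 1) / 2) ^ 2) with hg
  -- These are the constants for which (θⱼ - θᵢ)² - γ(θⱼ + θᵢ) = ρ holds whenever i and j are
  -- adjacent.
  have hR := hv.tridiagonal_relation (γ := -2 * c)
    (ρ := b ^ 2 + 4 * a * c + c ^ 2 * (D ^ 2 - 1)) (by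
      intro i j h1 h2
      have hj := (hp j).1
      have hi := (hp i).1
      rw [hj, hi, ← hD]
      rcases (by omega : (j : ℕ) = i ∨ (j : ℕ) = i + 1 ∨ (i : ℕ) = j + 1) with h | h | h
      · rw [h]; ring
      · rw [h]; push_cast; field_simp; ring
      · rw [h]; push_cast; field_simp; ring)
  have hthird : ∀ i, i + 3 ≤ n + 1 → (φ i - g i) - 3 * (φ (i + 1) - g (i + 1)) +
      3 * (φ (i + 2) - g (i + 2)) - (φ (i + 3) - g (i + 3)) = 0 := by
    intro i hi
    have key := hu.third_difference (by simp [hφ]) hR hi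
    rw [hp.extendNat_th (by omega), hp.extendNat_th (by omega), hp.extendNat_th (by omega),
      hp.extendNat_thStar (by omega), hp.extendNat_thStar (by omega),
      hp.extendNat_thStar (by omega)] at key
    refine Eq.trans ?_ key
    simp only [hg, ← hD]
    push_cast
    field_simp
    ring
  have h0 : φ 0 - g 0 = 0 := by simp [hφ, hg]
  have h1 : φ 1 - g 1 = 0 := by
    rw [hS, hg]; push_cast; ring
  have key := two_mul_eq_of_third_difference (e := fun i => φ i - g i) hthird h0 h1
  -- Eliminating ϕ₁ from the two corner identities gives φ_d - φ₁.
  have hlast : φ (n + 1) - g (n + 1) = 0 := by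
    have e1 := hL.firstSplit_one_sub_secondSplit_one (by omega)
    have e2 := hL.firstSplit_last_sub_secondSplit_one
    rw [hφi _ (by omega), hp.extendNat_th (by omega), hp.extendNat_th (by omega),
      hp.extendNat_thStar (by omega), hp.extendNat_thStar (by omega)] at e1 e2
    rw [hS] at e1
    have e3 : φ (n + 1) - D *
      (S + (b * c' + c * b') * (1 - (D + 1) / 2) - c * c' * (1 - (D + 1) / 2) ^ 2) =
        D * (D - 1) * (b * c' + c * b') := by
      have hn : (n : F) = D - 1 := by rw [hDn]; ring
      simp only [← hD, hn] at e1 e2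
      push_cast at e1 e2
      linear_combination e2 - e1
    simp only [hg, ← hD]
    rw [sub_eq_iff_eq_add.1 e3]
    field_simp
    ring
  refine ⟨S, fun i hi1 hid => ?_⟩
  rw [hφi i hi1]
  change φ i = g i
  rw [← sub_eq_zero]
  refine (mul_eq_zero.1 ?_).resolve_left h2
  rw [key i hid]
  -- For d = 1 the factor d - 1 is zero, but then i = 1 is the only index.
  rcases Nat.eq_zero_or_pos n with rfl | hn
  · obtain rfl : i = 1 := by omega
    simp
  · have hn0 : (n : F) ≠ 0 := hL.natCast_ne_zero hp (by omega) (by omega)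
    have hk := key (n + 1) le_rfl
    simp only [hlast, ← hD, mul_zero] at hk
    have : D - 1 = n := by rw [hDn]; ring
    rw [this] at hk
    have := (mul_eq_zero.1 hk.symm).resolve_left (mul_ne_zero hd0 hn0)
    rw [this, mul_zero]

theorem IsLeonardSystem.exists_isSplitParam {Φ : TridiagonalSystem F V d}
    (hL : Φ.IsLeonardSystem) (h2 : (2 : F) ≠ 0) {a b c a' b' c' : F}
    (hp : Φ.IsTypeIIParam a b c a' b' c') :
    ∃ t : AlgebraicClosure F, Φ.IsSplitParam (algebraMap F (AlgebraicClosure F) b)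
        (algebraMap F (AlgebraicClosure F) c) (algebraMap F (AlgebraicClosure F) b')
        (algebraMap F (AlgebraicClosure F) c') t := by
  obtain ⟨S, hS⟩ := hL.exists_firstSplit_eq h2 hp
  obtain ⟨S', hS'⟩ := hL.ddown.exists_firstSplit_eq h2 (hp.ddown h2)
  change ∀ i, 1 ≤ i → i ≤ d → Φ.secondSplit i = _ at hS'
  -- The stated form has t - bb*/2 in φ and t + bb*/2 in ϕ, so the constants must satisfy S' = S +
  -- bb*; the identity for φ₁ - ϕ₁ gives this.
  refine ⟨algebraMap F _ (S + b * b' / 2), fun i hi => ?_⟩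
  obtain ⟨h1, hid⟩ := Finset.mem_Icc.1 hi
  have hd0 : (d : F) ≠ 0 := hL.natCast_ne_zero hp (by omega) le_rfl
  have hSS : S' = S + b * b' := by
    have e := hL.firstSplit_one_sub_secondSplit_one (by omega : 1 ≤ d)
    rw [hS 1 le_rfl (by omega), hS' 1 le_rfl (by omega), hp.extendNat_th le_rfl,
      hp.extendNat_th (Nat.zero_le d), hp.extendNat_thStar (Nat.zero_le d),
      hp.extendNat_thStar (by omega)] at e
    refine mul_left_cancel₀ (mul_ne_zero (mul_ne_zero h2 h2) hd0) ?_
    push_cast at e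
    field_simp at e
    linear_combination -e
  subst hSS
  rw [hS i h1 hid, hS' i h1 hid]
  constructor
  · simp only [map_mul, map_add, map_sub, map_div₀, map_natCast, map_one, map_ofNat, map_pow]
    ring
  · simp only [map_mul, map_add, map_sub, map_div₀, map_natCast, map_one, map_ofNat, map_pow,
      map_neg]
    have h2' : (2 : AlgebraicClosure F) ≠ 0 := by
      rw [← map_ofNat (algebraMap F (AlgebraicClosure F)) 2]
      exact (_root_.map_ne_zero _).2 h2
    field_simp
    ring

theorem IsLeonardSystem.map_normDrinfeld_eq {Φ : TridiagonalSystem F V d}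
    (hL : Φ.IsLeonardSystem) (h2 : (2 : F) ≠ 0) {b c b' c' : F} {t ψ : AlgebraicClosure F}
    (ht : Φ.IsSplitParam (algebraMap F (AlgebraicClosure F) b)
        (algebraMap F (AlgebraicClosure F) c) (algebraMap F (AlgebraicClosure F) b')
        (algebraMap F (AlgebraicClosure F) c') t)
    (hψ : ψ ^ 2 = 4 * t * algebraMap F (AlgebraicClosure F) (c * c') +
      algebraMap F (AlgebraicClosure F) (b ^ 2 * c' ^ 2 + b' ^ 2 * c ^ 2))
    (hψ0 : c * c' = 0 → ψ = algebraMap F (AlgebraicClosure F) (b * c' + c * b')) :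
    (Φ.normDrinfeld b c b' c').map (algebraMap F (AlgebraicClosure F)) =
      C ((d.factorial : AlgebraicClosure F) ^ 2) * ∏ i ∈ Finset.Icc 1 d,
        (C (t + ψ * ((i : AlgebraicClosure F) - ((d : AlgebraicClosure F) + 1) / 2) +
          algebraMap F (AlgebraicClosure F) (c * c') *
            ((i : AlgebraicClosure F) - ((d : AlgebraicClosure F) + 1) / 2) ^ 2) - X) := by
  have h2' : (2 : AlgebraicClosure F) ≠ 0 := by
    rw [← map_ofNat (algebraMap F (AlgebraicClosure F)) 2]
    exact (_root_.map_ne_zero _).2 h2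
  set m := algebraMap F (AlgebraicClosure F) with hm
  -- Comparing values suffices, an algebraically closed field being infinite.
  refine Polynomial.funext fun L => ?_
  have key := hypergeometric_sum_eq_prod h2' d (α := m (c * c')) (β := m (b * c' + c * b'))
    (γ := m (b * b' / 2)) (t := t) (ψ := ψ) (by
      -- Here β² - 4αγ = (bc* + cb*)² - 2bb*cc* = b²c*² + b*²c².
      rw [hψ]
      simp only [map_mul, map_add, map_div₀, map_ofNat, map_pow]
      field_simp
      ring) (fun h => hψ0 ((map_eq_zero m).1 h)) L
  rw [eval_mul, eval_C, eval_prod]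
  simp only [eval_sub, eval_C, eval_X]
  rw [← key, normDrinfeld, Polynomial.map_sum, eval_finsetSum, Finset.sum_range]
  refine Finset.sum_congr rfl fun i _ => ?_
  rw [Polynomial.map_mul, map_C, eval_mul, eval_C, Polynomial.map_prod, eval_prod, hL.splitSeq_eq,
    map_prod]
  congr 1
  · refine Finset.prod_congr rfl fun k hk => ?_
    obtain ⟨hk1, hk2⟩ := Finset.mem_Icc.1 hk
    rw [(ht k (Finset.mem_Icc.2 ⟨hk1, by omega⟩)).1]
    simp only [map_mul, map_add, map_div₀, map_ofNat]
  · refine Finset.prod_congr rfl fun k hk => ?_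
    simp [normP]

end TridiagonalSystem

end LeonardPairs

/-! ### The main theorem -/

theorem mainTheorem4 {F : Type*} [Field F] {V : Type*} [AddCommGroup V] [Module F V]
    [Module.Finite F V] [Nontrivial V] {d : ℕ} (Φ : TridiagonalSystem F V d)
    (hL : Φ.IsLeonardSystem) (hII : Φ.IsTypeII) :
    (∃ a b c a' b' c' : F, Φ.IsTypeIIParam a b c a' b' c') ∧
    ∀ a b c a' b' c' : F, Φ.IsTypeIIParam a b c a' b' c' →
      (∃ t : AlgebraicClosure F, Φ.IsSplitParam (algebraMap F (AlgebraicClosure F) b)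
        (algebraMap F (AlgebraicClosure F) c) (algebraMap F (AlgebraicClosure F) b')
        (algebraMap F (AlgebraicClosure F) c') t) ∧
      ∀ t : AlgebraicClosure F, Φ.IsSplitParam (algebraMap F (AlgebraicClosure F) b)
          (algebraMap F (AlgebraicClosure F) c) (algebraMap F (AlgebraicClosure F) b')
          (algebraMap F (AlgebraicClosure F) c') t →
        (c * c' ≠ 0 → ∀ ψ : AlgebraicClosure F,
          ψ ^ 2 = 4 * t * algebraMap F (AlgebraicClosure F) (c * c') +
            algebraMap F (AlgebraicClosure F) (b ^ 2 * c' ^ 2 + b' ^ 2 * c ^ 2) →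
          ((Φ.normDrinfeld b c b' c').map (algebraMap F (AlgebraicClosure F))).roots =
            (Finset.Icc 1 d).val.map (fun i : ℕ =>
              t + ψ * ((i : AlgebraicClosure F) - ((d : AlgebraicClosure F) + 1) / 2) +
                algebraMap F (AlgebraicClosure F) (c * c') *
                  ((i : AlgebraicClosure F) - ((d : AlgebraicClosure F) + 1) / 2) ^ 2)) ∧
        (c * c' = 0 →
          ((Φ.normDrinfeld b c b' c').map (algebraMap F (AlgebraicClosure F))).roots =
            (Finset.Icc 1 d).val.map (fun i : ℕ =>
              t + algebraMap F (AlgebraicClosure F) (b * c' + c * b') *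
                ((i : AlgebraicClosure F) - ((d : AlgebraicClosure F) + 1) / 2))) := by
  have h2 := TridiagonalSystem.two_ne_zero_of_isTypeII hII
  refine ⟨hL.exists_isTypeIIParam hII, fun a b c a' b' c' hp =>
    ⟨hL.exists_isSplitParam h2 hp, fun t ht => ?_⟩⟩
  have hfac : ((d.factorial : AlgebraicClosure F) ^ 2) ≠ 0 := by
    refine pow_ne_zero 2 ?_
    rw [← Finset.prod_range_add_one_eq_factorial, Nat.cast_prod, Finset.prod_ne_zero_iff]
    intro i hi
    rw [← map_natCast (algebraMap F (AlgebraicClosure F)), _root_.map_ne_zero]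
    exact hL.natCast_ne_zero hp (by omega) (by have := Finset.mem_range.1 hi; omega)
  refine ⟨fun hc ψ hψ => ?_, fun hc => ?_⟩
  · rw [hL.map_normDrinfeld_eq h2 ht hψ fun h => absurd h hc, roots_C_mul_prod_C_sub_X hfac]
  -- When cc* = 0 the cross term 2bb*cc* vanishes, so bc* + cb* is itself an admissible ψ.
  · rw [hL.map_normDrinfeld_eq h2 ht (ψ := algebraMap F (AlgebraicClosure F) (b * c' + c * b'))
      ?_ fun _ => rfl, roots_C_mul_prod_C_sub_X hfac]
    · simp [hc]
    · rw [hc, map_zero, mul_zero, zero_add, ← map_pow]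
      congr 1
      linear_combination 2 * b * b' * hc
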